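/- All Hilbert spaces are finite-dimensional. A *sectorized Hilbert space* $A^i$ is a Hilbert space with an orthogonal decomposition $A=\bigoplus_{i\in\mathbb Z_N}A^i_\star$ into finitely many sectors; $\pi_A^i$ denotes the projector onto $A^i_\star$, and $\mathcal A:=\bigoplus_i\mathcal L(A^i_\star)$ the algebra of block-diagonal operators. A *channel* is a completely positive trace-preserving map. A channel $\Phi$ on $A$ is *sector-preserving* if $\pi_A^{k}\,\Phi(\pi_A^i X\pi_A^{i'})\,\pi_A^{k'}=0$ for all $X$ unless $k=i$ and $k'=i'$. A channel $\Psi:\mathcal L(D)\to\mathcal L(D\otimes D')$, where $D'$ is an unsectorized ancilla, is *sector-preserving* if the same holds with output projectors $\pi_D^l\otimes I_{D'}$. A *routed unitary* $(\lambda,U)$ from $A^i\otimes B^j$ to $C^k\otimes D^l$ consists of a Boolean matrix $\lambda_{ij}^{kl}$ and a linear map $U:A\otimes B\to C\otimes D$ with $(\pi_C^k\otimes\pi_D^l)U(\pi_A^i\otimes\pi_B^j)=0$ whenever $\lambda_{ij}^{kl}=0$, which restricts to a unitary from the practical input space to the practical output space, i.e. $U^\dagger U=P_{\rm in}$ and $UU^\dagger=P_{\rm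 out}$. Here $\mu_{ij}:=\sum_{kl}\lambda_{ij}^{kl}$ and $\gamma_{kl}:=\sum_{ij}\lambda_{ij}^{kl}$ (Boolean sums), and $P_{\rm in}=\sum_{ij}\mu_{ij}\,\pi_A^i\otimes\pi_B^j$ and $P_{\rm out}=\sum_{kl}\gamma_{kl}\,\pi_C^k\otimes\pi_D^l$ are the projectors onto the practical input and output spaces. For $M\in\mathcal A$ with blocks $M_i$ put $M^*:=\bigoplus_{ij}\mu_{ij}\,M_i\otimes I_{B^j_\star}$, and let $\mathcal A^*:=\{M^*:M\in\mathcal A\}$. Likewise, for $M\in\mathcal D:=\bigoplus_l\mathcal L(D^l_\star)$ put $M^*:=\bigoplus_{kl}\gamma_{kl}\,I_{C^k_\star}\otimes M_l$, and let $\mathcal D^*:=\{M^*:M\in\mathcal D\}$. These are operators on the practical spaces, extended by zero. The *exchange gate* of $A^i$ is the unitary $\mathtt{EXCH}_A$ on $A\otimes A'$ with $A'=A_1\otimes\dots\otimes A_N\otimes A_w$, $A_i\cong A^i_\star$, $\dim A_w=N$. On the $i$th sector of $A$ it swaps $A^i_\star$ with $A_i$, maps $|m\rangle_{A_w}$ to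 $|m+i \bmod N\rangle_{A_w}$, and acts as the identity on the other $A_j$. Write $A^O,A^I$ for $A'$ before and after the gate, and similarly $D^O,D^I$ for $D'$ and $\mathtt{EXCH}_D$. **Theorem.** Let $(\lambda,U)$ be a routed unitary from $A^i\otimes B^j$ to $C^k\otimes D^l$ such that all sectors of $A^i$ and of $D^l$ are nonzero. The following are equivalent. * **(R1)** For every sector-preserving channel $\Phi$ on $A$, every finite-dimensional $D'$ and every sector-preserving channel $\Psi:\mathcal L(D)\to\mathcal L(D\otimes D')$, $$\mathrm{Tr}_{CD}\big[(\mathrm{id}_C\otimes\Psi)\big(U\,(\Phi\otimes\mathrm{id}_B)(\rho)\,U^\dagger\big)\big]=\mathrm{Tr}_{CD}\big[(\mathrm{id}_C\otimes\Psi)(U\rho\,U^\dagger)\big]\quad\text{for all }\rho\in\mathcal L(A\otimes B).$$ * **(R2)** For every unitary $V\in\mathcal A$ there are unitaries $V'_l$ on $C$, one for each sector $l$ of $D$, such that $$U(V\otimes I_B)U^\dagger=\Big(\sum_l V'_l\otimes\pi_D^l\Big)P_{\rm out}.$$ * **(R3)** $[\,U\mathcal A^*U^\dagger,\mathcal D^*\,]=0$.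 * **(R4)** There is a channel $\Phi:\mathcal L(A\otimes B\otimes D^O)\to\mathcal L(D^I)$ such that, with $S:=\mathtt{EXCH}_D\,U\,\mathtt{EXCH}_A$ (each factor tensored with identities), for every operator $\rho$ on $A\otimes A^O\otimes B\otimes D^O$, $$\mathrm{Tr}_{C A^I D}\big[S\rho S^\dagger\big]=\Phi\big((P_{\rm in}\otimes I_{D^O})\,\mathrm{Tr}_{A^O}[\rho]\,(P_{\rm in}\otimes I_{D^O})\big).$$ -/

import Mathlib

open scoped Matrix Kronecker ComplexOrder

/-- A finite-dimensional sectorized Hilbert space, written in an orthonormal basis adapted to its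
sectors: the orthogonal direct sum `⨁ i, ℂ ^ (dim i)` of `N` sectors, sector `i` having dimension
`dim i`. -/
structure SectorizedSpace where
  /-- the number of sectors -/
  N : ℕ
  /-- the dimensions of the sectors -/
  dim : Fin N → ℕ

namespace SectorizedSpace

/-- Labels of the adapted orthonormal basis: `⟨i, x⟩` is the `x`-th basis vector of sector `i`. -/
abbrev Idx (A : SectorizedSpace) : Type := Σ i : Fin A.N, Fin (A.dim i)

/-- The orthogonal projector `π i` onto the sector `i`. -/
def proj (A : SectorizedSpace) (i : Fin A.N) : Matrix A.Idx A.Idx ℂ :=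
  Matrix.diagonal fun x => if x.1 = i then 1 else 0

/-- The sector-preserving algebra `⨁ i, L(A i)`: the block-diagonal operators. -/
def sectorAlgebra (A : SectorizedSpace) : Set (Matrix A.Idx A.Idx ℂ) :=
  {M | M = ∑ i, A.proj i * M * A.proj i}

/-- Basis labels of the ancilla `A' = A_1 ⊗ ⋯ ⊗ A_N ⊗ A_w` of the exchange gate: one sectorial
ancilla for every sector, of the dimension of that sector, and an `N`-dimensional which-sector
ancilla. -/
abbrev Anc (A : SectorizedSpace) : Type := (∀ i : Fin A.N, Fin (A.dim i)) × Fin A.N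

/-- The action of the exchange gate on the product basis of `A ⊗ A'`. If `A` is in sector `i`, its
state is swapped with the `i`-th sectorial ancilla and the which-sector ancilla is increased by `i`
modulo `N`. -/
def exchMap (A : SectorizedSpace) (z : A.Idx × A.Anc) : A.Idx × A.Anc :=
  (⟨z.1.1, z.2.1 z.1.1⟩, (Function.update z.2.1 z.1.1 z.1.2, z.2.2 + z.1.1))

/-- The exchange gate, as an operator on `A ⊗ A'`. -/
def exch (A : SectorizedSpace) : Matrix (A.Idx × A.Anc) (A.Idx × A.Anc) ℂ :=
  Matrix.of fun y z => if y = A.exchMap z then 1 else 0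

end SectorizedSpace

section Channels

variable {m n k I J : Type*}

/-- Partial trace over the first tensor factor. -/
def traceFst [Fintype m] (X : Matrix (m × n) (m × n) ℂ) : Matrix n n ℂ :=
  Matrix.of fun y y' => ∑ x, X (x, y) (x, y')

/-- `Φ ⊗ id`, for a linear map `Φ` from operators to operators. -/
def tensorId (k : Type*) (Φ : Matrix m m ℂ →ₗ[ℂ] Matrix n n ℂ) (X : Matrix (m × k) (m × k) ℂ) :
    Matrix (n × k) (n × k) ℂ :=
  Matrix.of fun p q => Φ (Matrix.of fun x x' => X (x, p.2) (x', q.2)) p.1 q.1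

/-- `id ⊗ Φ`, for a linear map `Φ` from operators to operators. -/
def idTensor (k : Type*) (Φ : Matrix m m ℂ →ₗ[ℂ] Matrix n n ℂ) (X : Matrix (k × m) (k × m) ℂ) :
    Matrix (k × n) (k × n) ℂ :=
  Matrix.of fun p q => Φ (Matrix.of fun x x' => X (p.1, x) (q.1, x')) p.2 q.2

/-- A quantum channel: a completely positive and trace-preserving linear map. -/
structure IsChannel [Fintype m] [Fintype n] (Φ : Matrix m m ℂ →ₗ[ℂ] Matrix n n ℂ) : Prop where
  completely_positive : ∀ (d : ℕ) (X : Matrix (m × Fin d) (m × Fin d) ℂ),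
    X.PosSemidef → (tensorId (Fin d) Φ X).PosSemidef
  trace_preserving : ∀ X : Matrix m m ℂ, (Φ X).trace = X.trace

/-- A map `Φ` on operators follows the route `r`, with respect to the projectors `π` onto the input
sectors and `σ` onto the output sectors: the component of `Φ` from the block `(i, i')` to the block
`(j, j')` vanishes unless `r` connects `i` with `j` and `i'` with `j'`. -/
def ChannelFollows [Fintype m] [Fintype n] (r : I → J → Bool) (π : I → Matrix m m ℂ)
    (σ : J → Matrix n n ℂ) (Φ : Matrix m m ℂ →ₗ[ℂ] Matrix n n ℂ) : Prop :=
  ∀ i i' j j', ¬ (r i j = true ∧ r i' j' = true) →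
    ∀ X : Matrix m m ℂ, σ j * Φ (π i * X * π i') * σ j' = 0

/-- The delta route, which sends every sector to the sector with the same label. -/
def deltaRoute {N : ℕ} (i j : Fin N) : Bool := decide (i = j)

/-- A sector-preserving channel on a sectorized system. -/
def IsSectorPreserving (A : SectorizedSpace)
    (Φ : Matrix A.Idx A.Idx ℂ →ₗ[ℂ] Matrix A.Idx A.Idx ℂ) : Prop :=
  IsChannel Φ ∧ ChannelFollows deltaRoute A.proj A.proj Φ

/-- A sector-preserving channel `D → D ⊗ D'` with an unsectorized `d`-dimensional output ancilla
`D'`, which implements a sector-preserving measurement. -/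
def IsSectorPreservingMeas (D : SectorizedSpace) (d : ℕ)
    (Ψ : Matrix D.Idx D.Idx ℂ →ₗ[ℂ] Matrix (D.Idx × Fin d) (D.Idx × Fin d) ℂ) : Prop :=
  IsChannel Ψ ∧
    ChannelFollows deltaRoute D.proj (fun l => D.proj l ⊗ₖ (1 : Matrix (Fin d) (Fin d) ℂ)) Ψ

end Channels

/-- Routes from `A ⊗ B` to `C ⊗ D`: Boolean matrices that relate the sectors `(i, j)` of the input
to the sectors `(k, l)` of the output. -/
abbrev Route (A B C D : SectorizedSpace) : Type :=
  Fin A.N × Fin B.N → Fin C.N × Fin D.N → Bool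

section Routed

variable {A B C D : SectorizedSpace}

/-- `μ i j`, the Boolean sum of `r` over the output sectors. -/
def Route.inSupport (r : Route A B C D) (i : Fin A.N) (j : Fin B.N) : Bool :=
  decide (∃ q, r (i, j) q = true)

/-- `γ k l`, the Boolean sum of `r` over the input sectors. -/
def Route.outSupport (r : Route A B C D) (k : Fin C.N) (l : Fin D.N) : Bool :=
  decide (∃ p, r p (k, l) = true)

/-- The projector of `A ⊗ B` onto `⨁ i j, μ i j • (A i ⊗ B j)`. -/
def supportProj (A B : SectorizedSpace) (μ : Fin A.N → Fin B.N → Bool) :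
    Matrix (A.Idx × B.Idx) (A.Idx × B.Idx) ℂ :=
  ∑ i, ∑ j, if μ i j then A.proj i ⊗ₖ B.proj j else 0

/-- The projector onto the practical input space. -/
def Route.inProj (r : Route A B C D) : Matrix (A.Idx × B.Idx) (A.Idx × B.Idx) ℂ :=
  supportProj A B r.inSupport

/-- The projector onto the practical output space. -/
def Route.outProj (r : Route A B C D) : Matrix (C.Idx × D.Idx) (C.Idx × D.Idx) ℂ :=
  supportProj C D r.outSupport

/-- `(r, U)` is a routed unitary from `A ⊗ B` to `C ⊗ D`: the map `U` follows the route `r`, and it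
restricts to a unitary from the practical input space to the practical output space. -/
structure IsRoutedUnitary (r : Route A B C D)
    (U : Matrix (C.Idx × D.Idx) (A.Idx × B.Idx) ℂ) : Prop where
  follows : ∀ i j k l, r (i, j) (k, l) = false →
    (C.proj k ⊗ₖ D.proj l) * U * (A.proj i ⊗ₖ B.proj j) = 0
  isometry : Uᴴ * U = r.inProj
  coisometry : U * Uᴴ = r.outProj

/-- No signalling with sector-preserving interventions on `A` and sector-preserving measurements
on `D`: applying `Φ` to `A`, then `U`, then `Ψ : D → D ⊗ D'`, and discarding `C` and `D`, gives the
same map `A ⊗ B → D'` as without `Φ`. -/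
def NoSignalling (U : Matrix (C.Idx × D.Idx) (A.Idx × B.Idx) ℂ) : Prop :=
  ∀ Φ : Matrix A.Idx A.Idx ℂ →ₗ[ℂ] Matrix A.Idx A.Idx ℂ, IsSectorPreserving A Φ →
  ∀ (d : ℕ) (Ψ : Matrix D.Idx D.Idx ℂ →ₗ[ℂ] Matrix (D.Idx × Fin d) (D.Idx × Fin d) ℂ),
    IsSectorPreservingMeas D d Ψ →
  ∀ ρ : Matrix (A.Idx × B.Idx) (A.Idx × B.Idx) ℂ,
    traceFst (traceFst (idTensor C.Idx Ψ (U * tensorId B.Idx Φ ρ * Uᴴ))) =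
      traceFst (traceFst (idTensor C.Idx Ψ (U * ρ * Uᴴ)))

/-- Every block-diagonal unitary `V` on `A` becomes, on the practical output space, a unitary on `C`
that is coherently controlled by the sector of `D`. -/
def LocalUnitariesAbsorbed (r : Route A B C D)
    (U : Matrix (C.Idx × D.Idx) (A.Idx × B.Idx) ℂ) : Prop :=
  ∀ V ∈ Matrix.unitaryGroup A.Idx ℂ, V ∈ A.sectorAlgebra →
    ∃ V' : Fin D.N → Matrix C.Idx C.Idx ℂ, (∀ l, V' l ∈ Matrix.unitaryGroup C.Idx ℂ) ∧
      U * (V ⊗ₖ (1 : Matrix B.Idx B.Idx ℂ)) * Uᴴ = (∑ l, V' l ⊗ₖ D.proj l) * r.outProj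

/-- The embedding `M* = ⨁ i j, μ i j • (M i ⊗ I)` of `M = ⨁ i, M i` on `A` into the operators on
`⨁ i j, μ i j • (A i ⊗ B j)`, extended by zero to `A ⊗ B`. -/
def embedFst (A B : SectorizedSpace) (μ : Fin A.N → Fin B.N → Bool)
    (M : Matrix A.Idx A.Idx ℂ) : Matrix (A.Idx × B.Idx) (A.Idx × B.Idx) ℂ :=
  ∑ i, ∑ j, if μ i j then (A.proj i * M * A.proj i) ⊗ₖ B.proj j else 0

/-- The embedding of an operator on the second factor, `M* = ⨁ k l, γ k l • (I ⊗ M l)`. -/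
def embedSnd (C D : SectorizedSpace) (γ : Fin C.N → Fin D.N → Bool)
    (M : Matrix D.Idx D.Idx ℂ) : Matrix (C.Idx × D.Idx) (C.Idx × D.Idx) ℂ :=
  ∑ k, ∑ l, if γ k l then C.proj k ⊗ₖ (D.proj l * M * D.proj l) else 0

/-- `[U 𝒜* U†, 𝒟*] = 0`. -/
def AlgebrasCommute (r : Route A B C D)
    (U : Matrix (C.Idx × D.Idx) (A.Idx × B.Idx) ℂ) : Prop :=
  ∀ M ∈ A.sectorAlgebra, ∀ M' ∈ D.sectorAlgebra,
    Commute (U * embedFst A B r.inSupport M * Uᴴ) (embedSnd C D r.outSupport M')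

/-- The circuit that applies the exchange gate to `A` and its ancilla, then `U`, then the exchange
gate to `D` and its ancilla. Its input is `(A ⊗ A') ⊗ (B ⊗ D')` and its output
`(C ⊗ A') ⊗ (D ⊗ D')`. -/
def exchCircuit (U : Matrix (C.Idx × D.Idx) (A.Idx × B.Idx) ℂ) :
    Matrix ((C.Idx × A.Anc) × (D.Idx × D.Anc)) ((A.Idx × A.Anc) × (B.Idx × D.Anc)) ℂ :=
  ((1 : Matrix (C.Idx × A.Anc) (C.Idx × A.Anc) ℂ) ⊗ₖ D.exch) *
    (U ⊗ₖ (1 : Matrix (A.Anc × D.Anc) (A.Anc × D.Anc) ℂ)).submatrix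
      (Equiv.prodProdProdComm C.Idx A.Anc D.Idx D.Anc)
      (Equiv.prodProdProdComm A.Idx A.Anc B.Idx D.Anc) *
    (A.exch ⊗ₖ (1 : Matrix (B.Idx × D.Anc) (B.Idx × D.Anc) ℂ))

/-- Discarding the input ancilla of the exchange gate on `A`, which leaves `(A ⊗ B) ⊗ D'`. -/
def discardAnc (A B D : SectorizedSpace)
    (ρ : Matrix ((A.Idx × A.Anc) × (B.Idx × D.Anc)) ((A.Idx × A.Anc) × (B.Idx × D.Anc)) ℂ) :
    Matrix ((A.Idx × B.Idx) × D.Anc) ((A.Idx × B.Idx) × D.Anc) ℂ :=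
  Matrix.of fun p q =>
    ∑ a : A.Anc, ρ ((p.1.1, a), (p.1.2, p.2)) ((q.1.1, a), (q.1.2, q.2))

/-- No signalling from the input ancilla of the exchange gate on `A` to the output ancilla of the
exchange gate on `D`: after discarding every other output, the circuit equals some channel that is
preceded by discarding the input ancilla of `A` and restricting to the practical input space. -/
def NoAncillaSignalling (r : Route A B C D)
    (U : Matrix (C.Idx × D.Idx) (A.Idx × B.Idx) ℂ) : Prop :=
  ∃ Φ : Matrix ((A.Idx × B.Idx) × D.Anc) ((A.Idx × B.Idx) × D.Anc) ℂ →ₗ[ℂ]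
      Matrix D.Anc D.Anc ℂ, IsChannel Φ ∧
    ∀ ρ : Matrix ((A.Idx × A.Anc) × (B.Idx × D.Anc)) ((A.Idx × A.Anc) × (B.Idx × D.Anc)) ℂ,
      traceFst (traceFst (exchCircuit U * ρ * (exchCircuit U)ᴴ)) =
        Φ ((r.inProj ⊗ₖ (1 : Matrix D.Anc D.Anc ℂ)) * discardAnc A B D ρ *
          (r.inProj ⊗ₖ (1 : Matrix D.Anc D.Anc ℂ)))

end Routed

/-!
All four properties are equivalent to a fifth one, `PullbackCommutes U`: in the Heisenberg picture,
the observables `U† (1 ⊗ M') U` with `M'` in the sector-preserving algebra `𝒟` of `D` commute with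
`𝒜 ⊗ 1`, for the sector-preserving algebra `𝒜` of `A`. Two descriptions make this usable.
By `forall_commute_kronecker_one_iff`, the commutant of `𝒜 ⊗ 1` is `⨁ i, π i ⊗ L(B)`; and by
`sectorAlgebra_subset_of_single` and `sectorAlgebra_subset_of_unitary`, `𝒜` is spanned by the matrix
units inside the sectors, and by its unitaries.

* Commuting algebras: `U` is a partial isometry between the practical spaces, whose projectors
  commute with `𝒜 ⊗ 1` and `1 ⊗ 𝒟`, so that commutation can be transported along `U`.
* Absorbed unitaries: `U (V ⊗ 1) U†` commutes with `1 ⊗ 𝒟` exactly when it is of the form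
  `∑ l, X l ⊗ π l`, and then each `X l` has the same initial and final projector, so that adding
  the complementary projector makes it unitary.
* No signalling: a sector-preserving measurement of `D` pulls the observables on its outcome back
  to `𝒟`, and an observable in `⨁ i, π i ⊗ L(B)` only sees the weights of the sectors of `A`,
  which trace preservation and the route constraint keep fixed. Conversely, conjugation by unitaries
  of `𝒜` and an interferometer that is sensitive to the expectation value of a unitary of `𝒟`
  suffice to recover the commutation.
* No signalling between ancillas: the exchange gate on `A` lies in `𝒜 ⊗ L(A')`, so it drops out
  if the commutation holds, and what remains is a channel on the practical input space. Conversely,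
  the matrix elements of the exchange gates in the ancilla basis are all the matrix units inside the
  sectors, so testing on basis states recovers the commutation.
-/

/-! ### The sector-preserving algebra and its commutant -/

namespace SectorizedSpace

variable {A B C D : SectorizedSpace}

theorem proj_mul_mul_proj_apply (i j : Fin A.N) (M : Matrix A.Idx A.Idx ℂ) (x y : A.Idx) :
    (A.proj i * M * A.proj j) x y = if x.1 = i ∧ y.1 = j then M x y else 0 := by
  rw [proj, proj, Matrix.mul_diagonal, Matrix.diagonal_mul]
  by_cases h : x.1 = i <;> by_cases h' : y.1 = j <;> simp [h, h']

theorem mem_sectorAlgebra_iff {M : Matrix A.Idx A.Idx ℂ} :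
    M ∈ A.sectorAlgebra ↔ ∀ x y : A.Idx, x.1 ≠ y.1 → M x y = 0 := by
  have key : ∀ x y, (∑ i, A.proj i * M * A.proj i) x y = if x.1 = y.1 then M x y else 0 := by
    intro x y
    simp only [Matrix.sum_apply, proj_mul_mul_proj_apply]
    by_cases h : x.1 = y.1
    · simp [h]
    · rw [if_neg h]
      refine Finset.sum_eq_zero fun i _ => if_neg ?_
      rintro ⟨h1, h2⟩
      exact h (h1.trans h2.symm)
  constructor
  · intro hM x y hxy
    have h : M = ∑ i, A.proj i * M * A.proj i := hM
    rw [h, key, if_neg hxy]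
  · intro h
    change M = ∑ i, A.proj i * M * A.proj i
    ext x y
    rw [key]
    split_ifs with hxy
    · rfl
    · exact h x y hxy

theorem single_mem_sectorAlgebra {x y : A.Idx} (h : x.1 = y.1) :
    Matrix.single x y (1 : ℂ) ∈ A.sectorAlgebra := by
  rw [mem_sectorAlgebra_iff]
  intro z w hzw
  rw [Matrix.single_apply, if_neg]
  rintro ⟨rfl, rfl⟩
  exact hzw h

/-- The sector-preserving algebra is spanned by the matrix units inside the sectors. -/
theorem sectorAlgebra_subset_of_single (p : Submodule ℂ (Matrix A.Idx A.Idx ℂ))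
    (h : ∀ x y : A.Idx, x.1 = y.1 → Matrix.single x y (1 : ℂ) ∈ p) :
    A.sectorAlgebra ⊆ p := by
  intro M hM
  rw [mem_sectorAlgebra_iff] at hM
  rw [SetLike.mem_coe, Matrix.matrix_eq_sum_single M]
  refine p.sum_mem fun x _ => p.sum_mem fun y _ => ?_
  by_cases hxy : x.1 = y.1
  · have := p.smul_mem (M x y) (h x y hxy)
    rwa [Matrix.smul_single, smul_eq_mul, mul_one] at this
  · rw [hM x y hxy, Matrix.single_zero]
    exact p.zero_mem

/-- The sector-preserving algebra is spanned by its unitaries: the matrix unit at `(x, y)` is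
`(S - R S) / 2` for the transposition `S` of `x` and `y` and the reflection `R` that negates the
basis vector `x`. -/
theorem sectorAlgebra_subset_of_unitary (p : Submodule ℂ (Matrix A.Idx A.Idx ℂ))
    (h : ∀ V ∈ Matrix.unitaryGroup A.Idx ℂ, V ∈ A.sectorAlgebra → V ∈ p) :
    A.sectorAlgebra ⊆ p := by
  refine sectorAlgebra_subset_of_single p fun x y hxy => ?_
  set S : Matrix A.Idx A.Idx ℂ := (Equiv.swap x y).permMatrix ℂ with hS
  set R : Matrix A.Idx A.Idx ℂ := Matrix.diagonal fun z => if z = x then -1 else 1 with hR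
  have hSa : ∀ z w, S z w = if Equiv.swap x y z = w then 1 else 0 := by
    intro z w
    simp [hS, Equiv.Perm.permMatrix, PEquiv.toMatrix_apply, eq_comm]
  have hSm : S ∈ A.sectorAlgebra := by
    rw [mem_sectorAlgebra_iff]
    intro z w hzw
    rw [hSa, if_neg]
    rintro rfl
    apply hzw
    by_cases h1 : z = x
    · rw [h1, Equiv.swap_apply_left, hxy]
    · by_cases h2 : z = y
      · rw [h2, Equiv.swap_apply_right, hxy]
      · rw [Equiv.swap_apply_of_ne_of_ne h1 h2]
  have hSu : S ∈ Matrix.unitaryGroup A.Idx ℂ := by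
    rw [Matrix.mem_unitaryGroup_iff, Matrix.star_eq_conjTranspose, hS,
      Matrix.conjTranspose_permMatrix, ← Matrix.permMatrix_mul]
    simp
  have hRu : R ∈ Matrix.unitaryGroup A.Idx ℂ := by
    rw [Matrix.mem_unitaryGroup_iff, Matrix.star_eq_conjTranspose, hR,
      Matrix.diagonal_conjTranspose, Matrix.diagonal_mul_diagonal, ← Matrix.diagonal_one]
    congr 1
    ext z
    by_cases hz : z = x <;> simp [hz]
  have hRSm : R * S ∈ A.sectorAlgebra := by
    rw [mem_sectorAlgebra_iff] at hSm ⊢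
    intro z w hzw
    rw [hR, Matrix.diagonal_mul, hSm z w hzw, mul_zero]
  have hxyS : Matrix.single x y (1 : ℂ) = (1 / 2 : ℂ) • (S - R * S) := by
    ext z w
    rw [Matrix.smul_apply, Matrix.sub_apply, hR, Matrix.diagonal_mul, hSa, Matrix.single_apply]
    by_cases hz : z = x
    · subst hz
      by_cases hw : y = w
      · simp [hw]; norm_num
      · simp [hw]
    · simp [hz, Ne.symm hz]
  rw [hxyS]
  exact p.smul_mem _ (p.sub_mem (h S hSu hSm) (h _ (mul_mem hRu hSu) hRSm))

theorem kronecker_one_mul_conjTranspose {m n : Type*} [Fintype m] [DecidableEq m] [Fintype n]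
    [DecidableEq n] {V : Matrix m m ℂ} (hV : V ∈ Matrix.unitaryGroup m ℂ) :
    (V ⊗ₖ (1 : Matrix n n ℂ)) * (V ⊗ₖ (1 : Matrix n n ℂ))ᴴ = 1 := by
  rw [Matrix.conjTranspose_kronecker, ← Matrix.mul_kronecker_mul, Matrix.conjTranspose_one,
    mul_one, ← Matrix.star_eq_conjTranspose, Matrix.mem_unitaryGroup_iff.mp hV,
    Matrix.one_kronecker_one]

theorem ite_kronecker_apply {m n : Type*} (b : Bool) (X : Matrix m m ℂ) (Y : Matrix n n ℂ)
    (p q : m × n) :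
    (if b then X ⊗ₖ Y else 0 : Matrix (m × n) (m × n) ℂ) p q =
      if b then X p.1 q.1 * Y p.2 q.2 else 0 := by
  cases b <;> simp [Matrix.kroneckerMap_apply]

theorem supportProj_eq_diagonal (μ : Fin A.N → Fin B.N → Bool) :
    supportProj A B μ = Matrix.diagonal fun p => if μ p.1.1 p.2.1 then 1 else 0 := by
  ext ⟨x, b⟩ ⟨x', b'⟩
  simp only [supportProj, Matrix.sum_apply, ite_kronecker_apply]
  rw [Finset.sum_eq_single x.1, Finset.sum_eq_single b.1]
  · by_cases hx : x = x' <;> by_cases hb : b = b' <;>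
      simp [proj, hx, hb]
  · intro j _ hj
    simp [proj, Matrix.diagonal_apply, hj.symm]
  · simp
  · intro i _ hi
    simp [proj, Matrix.diagonal_apply, hi.symm]
  · simp

/-- On block-diagonal operators, the embedding restricts `M ⊗ 1` to the support. -/
theorem embedFst_eq (μ : Fin A.N → Fin B.N → Bool) {M : Matrix A.Idx A.Idx ℂ}
    (hM : M ∈ A.sectorAlgebra) :
    embedFst A B μ M = supportProj A B μ * (M ⊗ₖ (1 : Matrix B.Idx B.Idx ℂ)) := by
  rw [mem_sectorAlgebra_iff] at hM
  rw [supportProj_eq_diagonal]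
  ext ⟨x, b⟩ ⟨x', b'⟩
  simp only [embedFst, Matrix.sum_apply, ite_kronecker_apply, Matrix.diagonal_mul,
    Matrix.kroneckerMap_apply, proj_mul_mul_proj_apply]
  rw [Finset.sum_eq_single x.1, Finset.sum_eq_single b.1]
  · by_cases hx : x.1 = x'.1 <;> by_cases hb : b = b' <;>
      simp [proj, Matrix.one_apply, hx, hb, hM x x']
  · intro j _ hj
    simp [proj, Matrix.diagonal_apply, hj.symm]
  · simp
  · intro i _ hi
    simp [hi.symm]
  · simp

theorem embedSnd_eq (γ : Fin C.N → Fin D.N → Bool) {M : Matrix D.Idx D.Idx ℂ}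
    (hM : M ∈ D.sectorAlgebra) :
    embedSnd C D γ M = supportProj C D γ * ((1 : Matrix C.Idx C.Idx ℂ) ⊗ₖ M) := by
  rw [mem_sectorAlgebra_iff] at hM
  rw [supportProj_eq_diagonal]
  ext ⟨c, d⟩ ⟨c', d'⟩
  simp only [embedSnd, Matrix.sum_apply, ite_kronecker_apply, Matrix.diagonal_mul,
    Matrix.kroneckerMap_apply, proj_mul_mul_proj_apply]
  rw [Finset.sum_eq_single c.1, Finset.sum_eq_single d.1]
  · by_cases hd : d.1 = d'.1 <;> by_cases hc : c = c' <;>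
      simp [proj, Matrix.one_apply, hd, hc, hM d d']
  · intro l _ hl
    simp [hl.symm]
  · simp
  · intro k _ hk
    simp [proj, Matrix.diagonal_apply, hk.symm]
  · simp

theorem commute_supportProj_kronecker_one (μ : Fin A.N → Fin B.N → Bool)
    {M : Matrix A.Idx A.Idx ℂ} (hM : M ∈ A.sectorAlgebra) :
    Commute (supportProj A B μ) (M ⊗ₖ (1 : Matrix B.Idx B.Idx ℂ)) := by
  rw [mem_sectorAlgebra_iff] at hM
  rw [commute_iff_eq, supportProj_eq_diagonal]
  ext p q
  rw [Matrix.diagonal_mul, Matrix.mul_diagonal, Matrix.kroneckerMap_apply, Matrix.one_apply]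
  by_cases h : p.1.1 = q.1.1
  · by_cases h2 : p.2 = q.2
    · rw [h, h2, mul_comm]
    · simp [h2]
  · simp [hM _ _ h]

theorem commute_supportProj_one_kronecker (γ : Fin C.N → Fin D.N → Bool)
    {M : Matrix D.Idx D.Idx ℂ} (hM : M ∈ D.sectorAlgebra) :
    Commute (supportProj C D γ) ((1 : Matrix C.Idx C.Idx ℂ) ⊗ₖ M) := by
  rw [mem_sectorAlgebra_iff] at hM
  rw [commute_iff_eq, supportProj_eq_diagonal]
  ext p q
  rw [Matrix.diagonal_mul, Matrix.mul_diagonal, Matrix.kroneckerMap_apply, Matrix.one_apply]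
  by_cases h : p.2.1 = q.2.1
  · by_cases h2 : p.1 = q.1
    · rw [h, h2, mul_comm]
    · simp [h2]
  · simp [hM _ _ h]

theorem single_kronecker_one_mul_apply {m n : Type*} [Fintype m] [DecidableEq m]
    [Fintype n] [DecidableEq n] (x y : m) (G : Matrix (m × n) (m × n) ℂ) (p q : m × n) :
    ((Matrix.single x y (1 : ℂ) ⊗ₖ (1 : Matrix n n ℂ)) * G) p q =
      if p.1 = x then G (y, p.2) q else 0 := by
  rw [Matrix.mul_apply, Fintype.sum_prod_type, Finset.sum_eq_single y, Finset.sum_eq_single p.2]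
  · simp [Matrix.kroneckerMap_apply, Matrix.single_apply, eq_comm]
  · intro b _ hb
    simp [Matrix.kroneckerMap_apply, hb.symm]
  · simp
  · intro b _ hb
    simp [Matrix.kroneckerMap_apply, hb.symm]
  · simp

theorem mul_single_kronecker_one_apply {m n : Type*} [Fintype m] [DecidableEq m]
    [Fintype n] [DecidableEq n] (x y : m) (G : Matrix (m × n) (m × n) ℂ) (p q : m × n) :
    (G * (Matrix.single x y (1 : ℂ) ⊗ₖ (1 : Matrix n n ℂ))) p q =
      if q.1 = y then G p (x, q.2) else 0 := by
  rw [Matrix.mul_apply, Fintype.sum_prod_type, Finset.sum_eq_single x, Finset.sum_eq_single q.2]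
  · simp [Matrix.kroneckerMap_apply, Matrix.single_apply, eq_comm]
  · intro b _ hb
    simp [Matrix.kroneckerMap_apply, hb]
  · simp
  · intro b _ hb
    simp [Matrix.kroneckerMap_apply, hb.symm]
  · simp

/-- The operators `M` such that `M ⊗ 1` commutes with a given operator. -/
def fstCommutant {m n : Type*} [Fintype m] [Fintype n] [DecidableEq n]
    (G : Matrix (m × n) (m × n) ℂ) : Submodule ℂ (Matrix m m ℂ) where
  carrier := {M | Commute (M ⊗ₖ (1 : Matrix n n ℂ)) G}
  add_mem' {a b} ha hb := by
    simpa only [Set.mem_ofPred_eq, Matrix.add_kronecker] using Commute.add_left ha hb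
  zero_mem' := by simp only [Set.mem_ofPred_eq, Matrix.zero_kronecker, Commute.zero_left]
  smul_mem' c a ha := by
    simpa only [Set.mem_ofPred_eq, Matrix.smul_kronecker] using Commute.smul_left ha c

/-- The commutant of `𝒜 ⊗ 1` is `⨁ i, π i ⊗ L(B)`: its elements are diagonal in the first factor,
with entries that only depend on the sector. -/
theorem forall_commute_kronecker_one_iff {n : Type*} [Fintype n] [DecidableEq n]
    (G : Matrix (A.Idx × n) (A.Idx × n) ℂ) :
    (∀ M ∈ A.sectorAlgebra, Commute (M ⊗ₖ (1 : Matrix n n ℂ)) G) ↔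
      (∀ x x' b b', x ≠ x' → G (x, b) (x', b') = 0) ∧
        ∀ x x' b b', x.1 = x'.1 → G (x, b) (x, b') = G (x', b) (x', b') := by
  constructor
  · intro h
    have h' : ∀ x y : A.Idx, x.1 = y.1 → ∀ p q : A.Idx × n,
        (if p.1 = x then G (y, p.2) q else 0) = if q.1 = y then G p (x, q.2) else 0 := by
      intro x y hxy p q
      rw [← single_kronecker_one_mul_apply, ← mul_single_kronecker_one_apply,
        (h _ (single_mem_sectorAlgebra hxy)).eq]
    constructor
    · intro x x' b b' hx
      simpa [hx.symm] using h' x x rfl (x, b) (x', b')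
    · intro x x' b b' hx
      simpa using (h' x x' hx (x, b) (x', b')).symm
  · rintro ⟨h1, h2⟩ M hM
    refine sectorAlgebra_subset_of_single (fstCommutant G) (fun x y hxy => ?_) hM
    change Commute _ G
    rw [commute_iff_eq]
    ext u v
    rw [single_kronecker_one_mul_apply, mul_single_kronecker_one_apply]
    rcases u with ⟨u, b⟩
    rcases v with ⟨v, b'⟩
    by_cases hu : u = x
    · by_cases hv : v = y
      · simp only [hu, hv, if_true]
        exact h2 _ _ _ _ hxy.symm
      · simp only [hu, hv, if_true, if_false]
        exact h1 _ _ _ _ (Ne.symm hv)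
    · by_cases hv : v = y
      · simp only [hu, hv, if_true, if_false]
        exact (h1 _ _ _ _ hu).symm
      · simp [hu, hv]

/-- The commutant of `1 ⊗ 𝒟` is `L(C) ⊗ ⨁ l, π l`. -/
theorem eq_sum_kronecker_proj (hD : ∀ l, 0 < D.dim l) {n : Type*} [Fintype n] [DecidableEq n]
    (W : Matrix (n × D.Idx) (n × D.Idx) ℂ)
    (h : ∀ M ∈ D.sectorAlgebra, Commute W ((1 : Matrix n n ℂ) ⊗ₖ M)) :
    W = ∑ l, (Matrix.of fun c c' => W (c, ⟨l, 0, hD l⟩) (c', ⟨l, 0, hD l⟩)) ⊗ₖ D.proj l := by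
  have hG : ∀ M ∈ D.sectorAlgebra, Commute (M ⊗ₖ (1 : Matrix n n ℂ))
      (W.submatrix Prod.swap Prod.swap) := by
    intro M hM
    have e : M ⊗ₖ (1 : Matrix n n ℂ) =
        ((1 : Matrix n n ℂ) ⊗ₖ M).submatrix (Equiv.prodComm _ _) (Equiv.prodComm _ _) := by
      ext p q
      simp [Matrix.kroneckerMap_apply, Matrix.one_apply, mul_comm]
    change Commute _ (W.submatrix (Equiv.prodComm _ _) (Equiv.prodComm _ _))
    rw [commute_iff_eq, e, Matrix.submatrix_mul_equiv, Matrix.submatrix_mul_equiv, (h M hM).eq]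
  obtain ⟨h1, h2⟩ := (forall_commute_kronecker_one_iff _).1 hG
  ext ⟨c, d⟩ ⟨c', d'⟩
  rw [Matrix.sum_apply, Finset.sum_eq_single d.1]
  · by_cases hd : d = d'
    · subst hd
      simpa [Matrix.kroneckerMap_apply, proj] using h2 d ⟨d.1, 0, hD d.1⟩ c c' rfl
    · simpa [Matrix.kroneckerMap_apply, proj, hd] using h1 d d' c c' hd
  · intro l _ hl
    simp [Matrix.kroneckerMap_apply, proj, Matrix.diagonal_apply, hl.symm]
  · simp

end SectorizedSpace

/-! ### Pulled-back observables, commuting algebras and absorbed unitaries -/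

section Pullback

open SectorizedSpace

variable {A B C D : SectorizedSpace}

/-- The hub of the equivalences: every observable `U† (1 ⊗ M') U` that is pulled back from the
sector-preserving algebra of `D` commutes with the sector-preserving algebra of `A`. -/
def PullbackCommutes (U : Matrix (C.Idx × D.Idx) (A.Idx × B.Idx) ℂ) : Prop :=
  ∀ M ∈ A.sectorAlgebra, ∀ M' ∈ D.sectorAlgebra,
    Commute (M ⊗ₖ (1 : Matrix B.Idx B.Idx ℂ)) (Uᴴ * ((1 : Matrix C.Idx C.Idx ℂ) ⊗ₖ M') * U)

variable {r : Route A B C D} {U : Matrix (C.Idx × D.Idx) (A.Idx × B.Idx) ℂ}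

/-- The operators on `D` whose pullback along `U` commutes with a given operator. -/
def pullbackCommutant (U : Matrix (C.Idx × D.Idx) (A.Idx × B.Idx) ℂ)
    (T : Matrix (A.Idx × B.Idx) (A.Idx × B.Idx) ℂ) : Submodule ℂ (Matrix D.Idx D.Idx ℂ) where
  carrier := {M | Commute T (Uᴴ * ((1 : Matrix C.Idx C.Idx ℂ) ⊗ₖ M) * U)}
  add_mem' {a b} ha hb := by
    simpa only [Set.mem_ofPred_eq, Matrix.kronecker_add, mul_add, add_mul, Matrix.mul_add,
      Matrix.add_mul] using Commute.add_right ha hb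
  zero_mem' := by
    simp only [Set.mem_ofPred_eq, Matrix.kronecker_zero, Matrix.mul_zero, Matrix.zero_mul,
      Commute.zero_right]
  smul_mem' c a ha := by
    simpa only [Set.mem_ofPred_eq, Matrix.kronecker_smul, Matrix.mul_smul, Matrix.smul_mul]
      using Commute.smul_right ha c

theorem pullbackCommutes_of_unitary
    (h : ∀ V ∈ Matrix.unitaryGroup A.Idx ℂ, V ∈ A.sectorAlgebra →
      ∀ V' ∈ Matrix.unitaryGroup D.Idx ℂ, V' ∈ D.sectorAlgebra →
        Commute (V ⊗ₖ (1 : Matrix B.Idx B.Idx ℂ))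
          (Uᴴ * ((1 : Matrix C.Idx C.Idx ℂ) ⊗ₖ V') * U)) :
    PullbackCommutes U := fun _ hM M' hM' =>
  sectorAlgebra_subset_of_unitary (fstCommutant (Uᴴ * ((1 : Matrix C.Idx C.Idx ℂ) ⊗ₖ M') * U))
    (fun V hV hVA => sectorAlgebra_subset_of_unitary
      (pullbackCommutant U (V ⊗ₖ (1 : Matrix B.Idx B.Idx ℂ))) (h V hV hVA) hM') hM

theorem pullbackCommutes_of_single
    (h : ∀ d d' : D.Idx, d.1 = d'.1 → ∀ M ∈ A.sectorAlgebra,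
      Commute (M ⊗ₖ (1 : Matrix B.Idx B.Idx ℂ))
        (Uᴴ * ((1 : Matrix C.Idx C.Idx ℂ) ⊗ₖ Matrix.single d d' (1 : ℂ)) * U)) :
    PullbackCommutes U := fun M hM _ hM' =>
  sectorAlgebra_subset_of_single (pullbackCommutant U (M ⊗ₖ (1 : Matrix B.Idx B.Idx ℂ)))
    (fun d d' hd => h d d' hd M hM) hM'

theorem Route.inProj_mul_self (r : Route A B C D) : r.inProj * r.inProj = r.inProj := by
  rw [Route.inProj, supportProj_eq_diagonal, Matrix.diagonal_mul_diagonal]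
  simp

theorem Route.conjTranspose_inProj (r : Route A B C D) : r.inProjᴴ = r.inProj := by
  rw [Route.inProj, supportProj_eq_diagonal, Matrix.diagonal_conjTranspose]
  congr 1
  ext p
  by_cases h : r.inSupport p.1.1 p.2.1 <;> simp [h]

namespace IsRoutedUnitary

/-- `U` vanishes off the practical input space, because `‖U (1 - P)‖² = ‖(1 - P) P (1 - P)‖`
for the projector `P` onto it. -/
theorem mul_inProj (hU : IsRoutedUnitary r U) : U * r.inProj = U := by
  have h : (U * r.inProj - U)ᴴ * (U * r.inProj - U) = 0 := by
    rw [Matrix.conjTranspose_sub, Matrix.conjTranspose_mul, Route.conjTranspose_inProj,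
      Matrix.sub_mul, Matrix.mul_sub, Matrix.mul_sub, Matrix.mul_assoc, ← Matrix.mul_assoc Uᴴ,
      hU.isometry]
    simp only [Matrix.mul_assoc, hU.isometry, Route.inProj_mul_self, sub_self]
  exact sub_eq_zero.mp (Matrix.conjTranspose_mul_self_eq_zero.mp h)

theorem inProj_mul_conjTranspose (hU : IsRoutedUnitary r U) : r.inProj * Uᴴ = Uᴴ := by
  have h := congrArg Matrix.conjTranspose hU.mul_inProj
  rwa [Matrix.conjTranspose_mul, Route.conjTranspose_inProj] at h

theorem outProj_mul (hU : IsRoutedUnitary r U) : r.outProj * U = U := by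
  rw [← hU.coisometry, Matrix.mul_assoc, hU.isometry, hU.mul_inProj]

theorem conjTranspose_mul_outProj (hU : IsRoutedUnitary r U) : Uᴴ * r.outProj = Uᴴ := by
  rw [← hU.coisometry, ← Matrix.mul_assoc, hU.isometry, hU.inProj_mul_conjTranspose]

/-- Conjugation by `U` carries commutation on the practical input space to commutation on the
practical output space. -/
theorem commute_conj_iff (hU : IsRoutedUnitary r U)
    {m : Matrix (A.Idx × B.Idx) (A.Idx × B.Idx) ℂ} {n : Matrix (C.Idx × D.Idx) (C.Idx × D.Idx) ℂ}
    (hm : Commute r.inProj m) (hn : Commute r.outProj n) :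
    Commute (U * m * Uᴴ) n ↔ Commute m (Uᴴ * n * U) := by
  have hm : r.inProj * m = m * r.inProj := hm
  have hn : r.outProj * n = n * r.outProj := hn
  constructor
  · intro h
    have h : U * m * Uᴴ * n = n * (U * m * Uᴴ) := h
    change m * (Uᴴ * n * U) = Uᴴ * n * U * m
    calc m * (Uᴴ * n * U) = m * r.inProj * Uᴴ * n * U := by
          rw [Matrix.mul_assoc m, hU.inProj_mul_conjTranspose]; simp only [Matrix.mul_assoc]
      _ = Uᴴ * (U * m * Uᴴ * n) * U := by
          rw [← hm, ← hU.isometry]; simp only [Matrix.mul_assoc]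
      _ = Uᴴ * n * U * (m * (Uᴴ * U)) := by rw [h]; simp only [Matrix.mul_assoc]
      _ = Uᴴ * n * (U * r.inProj) * m := by
          rw [hU.isometry, ← hm]; simp only [Matrix.mul_assoc]
      _ = Uᴴ * n * U * m := by rw [hU.mul_inProj]
  · intro h
    have h : m * (Uᴴ * n * U) = Uᴴ * n * U * m := h
    change U * m * Uᴴ * n = n * (U * m * Uᴴ)
    calc U * m * Uᴴ * n = U * m * (Uᴴ * r.outProj) * n := by rw [hU.conjTranspose_mul_outProj]
      _ = U * m * Uᴴ * (n * (U * Uᴴ)) := by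
          rw [hU.coisometry, ← hn]; simp only [Matrix.mul_assoc]
      _ = U * (m * (Uᴴ * n * U)) * Uᴴ := by simp only [Matrix.mul_assoc]
      _ = (U * Uᴴ) * n * U * m * Uᴴ := by rw [h]; simp only [Matrix.mul_assoc]
      _ = n * (r.outProj * U) * m * Uᴴ := by
          rw [hU.coisometry, hn]; simp only [Matrix.mul_assoc]
      _ = n * (U * m * Uᴴ) := by rw [hU.outProj_mul]; simp only [Matrix.mul_assoc]

theorem algebrasCommute_iff (hU : IsRoutedUnitary r U) :
    AlgebrasCommute r U ↔ PullbackCommutes U := by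
  refine forall₂_congr fun M hM => forall₂_congr fun M' hM' => ?_
  have hm := commute_supportProj_kronecker_one (B := B) r.inSupport hM
  have hn := commute_supportProj_one_kronecker (C := C) r.outSupport hM'
  rw [← hU.commute_conj_iff hm hn, embedFst_eq _ hM, embedSnd_eq _ hM']
  set m := M ⊗ₖ (1 : Matrix B.Idx B.Idx ℂ)
  set n := (1 : Matrix C.Idx C.Idx ℂ) ⊗ₖ M'
  change Commute (U * (r.inProj * m) * Uᴴ) (r.outProj * n) ↔ _
  have hn : r.outProj * n = n * r.outProj := hn
  rw [← Matrix.mul_assoc U, hU.mul_inProj]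
  have h1 : U * m * Uᴴ * (r.outProj * n) = U * m * Uᴴ * n := by
    rw [← Matrix.mul_assoc, Matrix.mul_assoc _ Uᴴ, hU.conjTranspose_mul_outProj]
  have h2 : r.outProj * n * (U * m * Uᴴ) = n * (U * m * Uᴴ) := by
    rw [hn, Matrix.mul_assoc, Matrix.mul_assoc, ← Matrix.mul_assoc r.outProj, hU.outProj_mul]
  rw [commute_iff_eq, commute_iff_eq, h1, h2]

/-- The image of a unitary of `A` is a partial isometry `W = ⨁ l, X l ⊗ 1` with initial and final
projector `⨁ l, Q l ⊗ 1`, so the operators `X l + (1 - Q l)` are unitary. -/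
theorem localUnitariesAbsorbed_of_pullbackCommutes (hU : IsRoutedUnitary r U)
    (hD : ∀ l, 0 < D.dim l) (h : PullbackCommutes U) : LocalUnitariesAbsorbed r U := by
  intro V hV hVA
  set W := U * (V ⊗ₖ (1 : Matrix B.Idx B.Idx ℂ)) * Uᴴ with hW
  have hP := commute_supportProj_kronecker_one (B := B) r.inSupport hVA
  have hV1 := kronecker_one_mul_conjTranspose (n := B.Idx) hV
  set v := V ⊗ₖ (1 : Matrix B.Idx B.Idx ℂ)
  have hP : r.inProj * v = v * r.inProj := hP
  have hWc : ∀ M ∈ D.sectorAlgebra, Commute W ((1 : Matrix C.Idx C.Idx ℂ) ⊗ₖ M) := fun M hM =>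
    (hU.commute_conj_iff hP (commute_supportProj_one_kronecker _ hM)).mpr (h V hVA M hM)
  have hWW : W * Wᴴ = r.outProj := by
    calc W * Wᴴ = U * v * (Uᴴ * U) * vᴴ * Uᴴ := by
          simp only [hW, Matrix.conjTranspose_mul, Matrix.conjTranspose_conjTranspose,
            Matrix.mul_assoc]
      _ = U * r.inProj * (v * vᴴ) * Uᴴ := by
          rw [hU.isometry, Matrix.mul_assoc U, ← hP]; simp only [Matrix.mul_assoc]
      _ = r.outProj := by rw [hV1, hU.mul_inProj, Matrix.mul_one, hU.coisometry]
  have hPW : W * r.outProj = W := by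
    rw [hW, Matrix.mul_assoc, hU.conjTranspose_mul_outProj]
  set X : Fin D.N → Matrix C.Idx C.Idx ℂ :=
    fun l => Matrix.of fun c c' => W (c, ⟨l, 0, hD l⟩) (c', ⟨l, 0, hD l⟩) with hX
  set Q : Fin D.N → Matrix C.Idx C.Idx ℂ :=
    fun l => Matrix.diagonal fun c => if r.outSupport c.1 l then 1 else 0 with hQ
  have hWX : W = ∑ l, X l ⊗ₖ D.proj l := eq_sum_kronecker_proj hD W hWc
  have hWa : ∀ c d c' d', W (c, d) (c', d') = if d = d' then X d.1 c c' else 0 := by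
    intro c d c' d'
    rw [hWX, Matrix.sum_apply, Finset.sum_eq_single d.1]
    · by_cases hd : d = d' <;> simp [Matrix.kroneckerMap_apply, proj, hd]
    · intro l _ hl
      simp [Matrix.kroneckerMap_apply, proj, Matrix.diagonal_apply, hl.symm]
    · simp
  have hXX : ∀ l, X l * (X l)ᴴ = Q l := by
    intro l
    ext c c'
    have := congrFun (congrFun hWW (c, ⟨l, 0, hD l⟩)) (c', ⟨l, 0, hD l⟩)
    rw [Matrix.mul_apply, Fintype.sum_prod_type] at this
    simp only [Matrix.conjTranspose_apply, hWa, Route.outProj, supportProj_eq_diagonal] at this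
    rw [hQ, Matrix.mul_apply]
    simpa [Matrix.diagonal_apply] using this
  have hXQ : ∀ l, X l * Q l = X l := by
    intro l
    ext c c'
    have := congrFun (congrFun hPW (c, ⟨l, 0, hD l⟩)) (c', ⟨l, 0, hD l⟩)
    rw [Route.outProj, supportProj_eq_diagonal, Matrix.mul_diagonal] at this
    rw [hQ, Matrix.mul_diagonal]
    exact this
  have hQQ : ∀ l, Q l * Q l = Q l := fun l => by
    rw [hQ, Matrix.diagonal_mul_diagonal]; simp
  have hQh : ∀ l, (Q l)ᴴ = Q l := fun l => by
    rw [hQ, Matrix.diagonal_conjTranspose]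
    congr 1
    ext c
    by_cases h : r.outSupport c.1 l <;> simp [h]
  refine ⟨fun l => X l + (1 - Q l), fun l => ?_, ?_⟩
  · rw [Matrix.mem_unitaryGroup_iff, Matrix.star_eq_conjTranspose, Matrix.conjTranspose_add,
      Matrix.conjTranspose_sub, Matrix.conjTranspose_one, hQh]
    have h1 : Q l * (X l)ᴴ = (X l)ᴴ := by
      have := congrArg Matrix.conjTranspose (hXQ l)
      rwa [Matrix.conjTranspose_mul, hQh] at this
    simp only [add_mul, mul_add, mul_sub, sub_mul, mul_one, one_mul, hXX, hXQ, hQQ, h1]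
    abel
  · ext ⟨c, d⟩ ⟨c', d'⟩
    rw [hWa, Route.outProj, supportProj_eq_diagonal, Matrix.mul_diagonal, Matrix.sum_apply,
      Finset.sum_eq_single d.1]
    · by_cases hd : d = d'
      · subst hd
        have h1 := congrFun (congrFun (hXQ d.1) c) c'
        rw [hQ, Matrix.mul_diagonal] at h1
        by_cases hs : r.outSupport c'.1 d.1
        · simp [Matrix.kroneckerMap_apply, proj, hs, hQ, Matrix.diagonal_apply, Matrix.one_apply]
          grind
        · simpa [hs, eq_comm] using h1
      · simp [Matrix.kroneckerMap_apply, proj, hd]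
    · intro l _ hl
      simp [Matrix.kroneckerMap_apply, proj, Matrix.diagonal_apply, hl.symm]
    · simp

theorem pullbackCommutes_of_localUnitariesAbsorbed (hU : IsRoutedUnitary r U)
    (h : LocalUnitariesAbsorbed r U) : PullbackCommutes U := by
  refine pullbackCommutes_of_unitary fun V hV hVA V' _ hVD => ?_
  have hP := commute_supportProj_kronecker_one (B := B) r.inSupport hVA
  have hn := commute_supportProj_one_kronecker (C := C) r.outSupport hVD
  rw [← hU.commute_conj_iff hP hn]
  obtain ⟨Y, _, hY⟩ := h V hV hVA
  rw [hY]
  refine Commute.mul_left (Commute.sum_left _ _ _ fun l _ => ?_) hn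
  rw [commute_iff_eq, ← Matrix.mul_kronecker_mul, ← Matrix.mul_kronecker_mul, one_mul, mul_one]
  congr 1
  ext x y
  rw [proj, Matrix.diagonal_mul, Matrix.mul_diagonal]
  by_cases hxy : x.1 = y.1
  · rw [hxy, mul_comm]
  · rw [mem_sectorAlgebra_iff.mp hVD x y hxy, mul_zero, zero_mul]

end IsRoutedUnitary

end Pullback

/-! ### Kraus maps and sector-preserving channels -/

section Kraus

variable {m n k κ : Type*}

/-- The completely positive map `X ↦ ∑ a, L a X (L a)†` with Kraus operators `L`. -/
def krausMap [Fintype m] [Fintype κ] (L : κ → Matrix n m ℂ) :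
    Matrix m m ℂ →ₗ[ℂ] Matrix n n ℂ where
  toFun X := ∑ a, L a * X * (L a)ᴴ
  map_add' X Y := by simp only [Matrix.mul_add, Matrix.add_mul, Finset.sum_add_distrib]
  map_smul' c X := by
    simp only [Matrix.mul_smul, Matrix.smul_mul, Finset.smul_sum, RingHom.id_apply]

theorem krausMap_apply [Fintype m] [Fintype κ] (L : κ → Matrix n m ℂ) (X : Matrix m m ℂ) :
    krausMap L X = ∑ a, L a * X * (L a)ᴴ := rfl

theorem tensorId_krausMap [Fintype m] [Fintype κ] [Fintype k] [DecidableEq k]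
    (L : κ → Matrix n m ℂ) (X : Matrix (m × k) (m × k) ℂ) :
    tensorId k (krausMap L) X =
      ∑ a, (L a ⊗ₖ (1 : Matrix k k ℂ)) * X * (L a ⊗ₖ (1 : Matrix k k ℂ))ᴴ := by
  ext ⟨x, y⟩ ⟨x', y'⟩
  simp only [tensorId, krausMap_apply, Matrix.of_apply, Matrix.sum_apply]
  refine Finset.sum_congr rfl fun a _ => ?_
  simp [Matrix.mul_apply, Fintype.sum_prod_type, Matrix.kroneckerMap_apply, Matrix.one_apply,
    apply_ite (starRingEnd ℂ), Finset.sum_mul]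

theorem isChannel_krausMap [Fintype m] [DecidableEq m] [Fintype n] [Fintype κ]
    (L : κ → Matrix n m ℂ) (hL : ∑ a, (L a)ᴴ * L a = 1) : IsChannel (krausMap L) where
  completely_positive d X hX := by
    rw [tensorId_krausMap]
    exact Matrix.posSemidef_sum _ fun a _ => hX.mul_mul_conjTranspose_same _
  trace_preserving X := by
    rw [krausMap_apply, Matrix.trace_sum]
    simp only [Matrix.trace_mul_cycle _ X]
    rw [← Matrix.trace_sum, ← Finset.sum_mul, hL, one_mul]

end Kraus

section NoSignalling

open SectorizedSpace

variable {A B C D : SectorizedSpace}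

theorem trace_traceFst {m n : Type*} [Fintype m] [Fintype n] (X : Matrix (m × n) (m × n) ℂ) :
    (traceFst X).trace = X.trace := by
  simp only [Matrix.trace, traceFst, Matrix.diag_apply, Matrix.of_apply, Fintype.sum_prod_type]
  exact Finset.sum_comm

theorem trace_mul_traceFst {m n : Type*} [Fintype m] [DecidableEq m] [Fintype n]
    (F : Matrix n n ℂ) (X : Matrix (m × n) (m × n) ℂ) :
    (F * traceFst X).trace = (((1 : Matrix m m ℂ) ⊗ₖ F) * X).trace := by
  rw [← trace_traceFst]
  congr 1
  ext y y'
  simp only [traceFst, Matrix.mul_apply, Matrix.of_apply, Fintype.sum_prod_type,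
    Matrix.kroneckerMap_apply, Matrix.one_apply, ite_mul, one_mul, zero_mul, Finset.mul_sum]
  rw [Finset.sum_comm]
  refine Finset.sum_congr rfl fun x _ => ?_
  rw [Finset.sum_eq_single x]
  · simp
  · intro x' _ hx'
    simp [hx'.symm]
  · simp

theorem traceFst_idTensor {k m n : Type*} [Fintype k] [Fintype m]
    (Φ : Matrix m m ℂ →ₗ[ℂ] Matrix n n ℂ) (X : Matrix (k × m) (k × m) ℂ) :
    traceFst (idTensor k Φ X) = Φ (traceFst X) := by
  have h : traceFst X = ∑ c, Matrix.of fun x x' => X (c, x) (c, x') := by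
    ext x x'
    simp [traceFst, Matrix.sum_apply]
  rw [h, map_sum]
  ext y y'
  simp [traceFst, idTensor, Matrix.sum_apply]

theorem sum_proj (A : SectorizedSpace) : ∑ i, A.proj i = 1 := by
  ext x y
  rw [Matrix.sum_apply, Finset.sum_eq_single x.1]
  · by_cases h : x = y <;> simp [proj, Matrix.one_apply, h]
  · intro i _ hi
    simp [proj, Matrix.diagonal_apply, hi.symm]
  · simp

theorem proj_mul_self (A : SectorizedSpace) (i : Fin A.N) : A.proj i * A.proj i = A.proj i := by
  rw [proj, Matrix.diagonal_mul_diagonal]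
  simp

theorem proj_kronecker_one {n : Type*} [DecidableEq n] (i : Fin A.N) :
    A.proj i ⊗ₖ (1 : Matrix n n ℂ) = Matrix.diagonal fun p => if p.1.1 = i then 1 else 0 := by
  rw [proj, ← Matrix.diagonal_one, Matrix.diagonal_kronecker_diagonal]
  simp

theorem trace_eq_sum_trace_proj (X : Matrix A.Idx A.Idx ℂ) :
    X.trace = ∑ i, (A.proj i * X * A.proj i).trace := by
  simp only [Matrix.trace_mul_cycle, proj_mul_self]
  rw [← Matrix.trace_sum, ← Finset.sum_mul, sum_proj, one_mul]

/-- A sector-preserving channel preserves the weight of every sector. -/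
theorem IsSectorPreserving.trace_proj {Φ : Matrix A.Idx A.Idx ℂ →ₗ[ℂ] Matrix A.Idx A.Idx ℂ}
    (hΦ : IsSectorPreserving A Φ) (i : Fin A.N) (X : Matrix A.Idx A.Idx ℂ) :
    (A.proj i * Φ X * A.proj i).trace = (A.proj i * X * A.proj i).trace := by
  have hX : A.proj i * Φ X * A.proj i = A.proj i * Φ (A.proj i * X * A.proj i) * A.proj i := by
    have e : X = ∑ j, ∑ j', A.proj j * X * A.proj j' := by
      simp only [← Finset.mul_sum, ← Finset.sum_mul, sum_proj, one_mul, mul_one]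
    conv_lhs => rw [e]
    simp only [map_sum, Finset.mul_sum, Finset.sum_mul]
    rw [Finset.sum_eq_single i, Finset.sum_eq_single i]
    · intro j _ hj
      exact hΦ.2 i j i i (by simp [deltaRoute, hj]) X
    · simp
    · intro j _ hj
      exact Finset.sum_eq_zero fun j' _ => hΦ.2 j j' i i (by simp [deltaRoute, hj]) X
    · simp
  rw [hX, ← hΦ.1.trace_preserving (A.proj i * X * A.proj i),
    trace_eq_sum_trace_proj (Φ _), Finset.sum_eq_single i]
  · intro j _ hj
    rw [hΦ.2 i i j j (by simp [deltaRoute, hj.symm]) X, Matrix.trace_zero]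
  · simp

theorem trace_proj_mul_mul_proj (i : Fin A.N) (X : Matrix A.Idx A.Idx ℂ) :
    (A.proj i * X * A.proj i).trace = ∑ x, X ⟨i, x⟩ ⟨i, x⟩ := by
  simp only [Matrix.trace, Matrix.diag_apply, proj_mul_mul_proj_apply, and_self]
  rw [Fintype.sum_sigma, Finset.sum_eq_single i]
  · simp
  · intro j _ hj
    simp [hj]
  · simp

/-- The observables of `⨁ i, π i ⊗ L(B)` do not detect sector-preserving channels on `A`. -/
theorem IsSectorPreserving.trace_mul_tensorId
    {Φ : Matrix A.Idx A.Idx ℂ →ₗ[ℂ] Matrix A.Idx A.Idx ℂ} (hΦ : IsSectorPreserving A Φ)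
    (hA : ∀ i, 0 < A.dim i) {k : Type*} [Fintype k] [DecidableEq k]
    {G : Matrix (A.Idx × k) (A.Idx × k) ℂ}
    (hG : ∀ M ∈ A.sectorAlgebra, Commute (M ⊗ₖ (1 : Matrix k k ℂ)) G)
    (ρ : Matrix (A.Idx × k) (A.Idx × k) ℂ) :
    (G * tensorId k Φ ρ).trace = (G * ρ).trace := by
  obtain ⟨h1, h2⟩ := (forall_commute_kronecker_one_iff G).1 hG
  have key : ∀ σ : Matrix (A.Idx × k) (A.Idx × k) ℂ, (G * σ).trace =
      ∑ i, ∑ b, ∑ b', G (⟨i, 0, hA i⟩, b) (⟨i, 0, hA i⟩, b') *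
        (A.proj i * (Matrix.of fun x x' => σ (x, b') (x', b)) * A.proj i).trace := by
    intro σ
    have e : ∀ (x : A.Idx) (b : k), (G * σ) (x, b) (x, b) =
        ∑ b', G (⟨x.1, 0, hA x.1⟩, b) (⟨x.1, 0, hA x.1⟩, b') * σ (x, b') (x, b) := by
      intro x b
      rw [Matrix.mul_apply, Fintype.sum_prod_type, Finset.sum_eq_single x]
      · exact Finset.sum_congr rfl fun b' _ => by rw [h2 x ⟨x.1, 0, hA x.1⟩ b b' rfl]
      · intro y _ hy
        exact Finset.sum_eq_zero fun b' _ => by rw [h1 _ _ _ _ hy.symm, zero_mul]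
      · simp
    simp only [trace_proj_mul_mul_proj, Matrix.of_apply]
    rw [Matrix.trace]
    simp only [Matrix.diag_apply, Fintype.sum_prod_type, e, Fintype.sum_sigma, Finset.mul_sum]
    refine Finset.sum_congr rfl fun i _ => ?_
    rw [Finset.sum_comm]
    exact Finset.sum_congr rfl fun b _ => Finset.sum_comm
  rw [key, key]
  refine Finset.sum_congr rfl fun i _ => Finset.sum_congr rfl fun b _ =>
    Finset.sum_congr rfl fun b' _ => ?_
  congr 1
  exact hΦ.trace_proj i (Matrix.of fun x x' => ρ (x, b') (x', b))

/-- In the Heisenberg picture, a sector-preserving measurement of `D` maps the observables on its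
outcome to the sector-preserving algebra. -/
theorem IsSectorPreservingMeas.exists_observable {d : ℕ}
    {Ψ : Matrix D.Idx D.Idx ℂ →ₗ[ℂ] Matrix (D.Idx × Fin d) (D.Idx × Fin d) ℂ}
    (hΨ : IsSectorPreservingMeas D d Ψ) (s s' : Fin d) :
    ∃ F ∈ D.sectorAlgebra, ∀ Y, traceFst (Ψ Y) s s' = (F * Y).trace := by
  refine ⟨Matrix.of fun y x => traceFst (Ψ (Matrix.single x y 1)) s s', ?_, fun Y => ?_⟩
  · rw [mem_sectorAlgebra_iff]
    intro y x hyx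
    simp only [Matrix.of_apply, traceFst]
    refine Finset.sum_eq_zero fun z _ => ?_
    have h : (D.proj z.1 ⊗ₖ (1 : Matrix (Fin d) (Fin d) ℂ)) *
        Ψ (D.proj x.1 * Matrix.single x y 1 * D.proj y.1) *
        (D.proj z.1 ⊗ₖ (1 : Matrix (Fin d) (Fin d) ℂ)) = 0 := hΨ.2 x.1 y.1 z.1 z.1 (by
      rintro ⟨h1, h2⟩
      simp only [deltaRoute, decide_eq_true_eq] at h1 h2
      exact hyx (h2.trans h1.symm)) (Matrix.single x y 1)
    have e : D.proj x.1 * Matrix.single x y (1 : ℂ) * D.proj y.1 = Matrix.single x y 1 := by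
      ext u v
      rw [proj_mul_mul_proj_apply, Matrix.single_apply]
      by_cases hu : x = u <;> by_cases hv : y = v <;> simp [hu, hv]
    rw [e] at h
    have h := congrFun (congrFun h (z, s)) (z, s')
    rw [proj_kronecker_one, Matrix.mul_diagonal, Matrix.diagonal_mul] at h
    simpa using h
  · let f : Matrix D.Idx D.Idx ℂ →ₗ[ℂ] ℂ :=
      { toFun := fun Y => traceFst (Ψ Y) s s'
        map_add' := fun X Y => by
          simp [traceFst, Finset.sum_add_distrib]
        map_smul' := fun c X => by
          simp [traceFst, Finset.mul_sum] }
    change f Y = _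
    have e : Y = ∑ x, ∑ y, Y x y • Matrix.single x y (1 : ℂ) := by
      conv_lhs => rw [Matrix.matrix_eq_sum_single Y]
      simp only [Matrix.smul_single, smul_eq_mul, mul_one]
    conv_lhs => rw [e]
    simp only [map_sum, map_smul, smul_eq_mul, Matrix.trace, Matrix.diag_apply, Matrix.mul_apply,
      Matrix.of_apply]
    rw [Finset.sum_comm]
    refine Finset.sum_congr rfl fun y _ => Finset.sum_congr rfl fun x _ => mul_comm _ _

variable {r : Route A B C D} {U : Matrix (C.Idx × D.Idx) (A.Idx × B.Idx) ℂ}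

theorem trace_mul_traceFst_conj (F : Matrix D.Idx D.Idx ℂ)
    (σ : Matrix (A.Idx × B.Idx) (A.Idx × B.Idx) ℂ) :
    (F * traceFst (U * σ * Uᴴ)).trace =
      (Uᴴ * ((1 : Matrix C.Idx C.Idx ℂ) ⊗ₖ F) * U * σ).trace := by
  rw [trace_mul_traceFst, ← Matrix.mul_assoc, Matrix.trace_mul_comm]
  simp only [Matrix.mul_assoc]

theorem noSignalling_of_pullbackCommutes (hA : ∀ i, 0 < A.dim i) (h : PullbackCommutes U) :
    NoSignalling U := by
  intro Φ hΦ d Ψ hΨ ρ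
  rw [traceFst_idTensor, traceFst_idTensor]
  ext s s'
  obtain ⟨F, hF, hΨF⟩ := hΨ.exists_observable s s'
  rw [hΨF, hΨF, trace_mul_traceFst_conj, trace_mul_traceFst_conj,
    hΦ.trace_mul_tensorId hA fun M hM => h M hM F hF]

/-- Conjugation by a block-diagonal operator follows the delta route; `s p` is the sector of the
output basis vector `p`. -/
theorem channelFollows_krausMap {n : Type*} [Fintype n] [DecidableEq n] {T : Matrix n A.Idx ℂ}
    (s : n → Fin A.N) (hT : ∀ p x, s p ≠ x.1 → T p x = 0) :
    ChannelFollows deltaRoute A.proj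
      (fun i => Matrix.diagonal fun p => if s p = i then 1 else 0)
      (krausMap fun _ : Unit => T) := by
  intro i i' j j' hr X
  ext p q
  rw [Matrix.mul_diagonal, Matrix.diagonal_mul, Matrix.zero_apply]
  by_cases hp : s p = j
  · by_cases hq : s q = j'
    · subst hp hq
      simp only [krausMap_apply, Finset.univ_unique, Finset.sum_const, Finset.card_singleton,
        one_smul, Matrix.mul_apply (N := Tᴴ), Matrix.mul_apply (M := T),
        Matrix.conjTranspose_apply, proj_mul_mul_proj_apply]
      simp only [if_true, one_mul, mul_one]
      refine Finset.sum_eq_zero fun v _ => ?_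
      rw [Finset.sum_mul]
      refine Finset.sum_eq_zero fun u _ => ?_
      by_cases hu : s p = u.1
      · by_cases hv : s q = v.1
        · rw [if_neg, mul_zero, zero_mul]
          rintro ⟨rfl, rfl⟩
          exact hr (by simp [deltaRoute, hu, hv])
        · rw [hT q v hv, star_zero, mul_zero]
      · rw [hT p u hu, zero_mul, zero_mul]
    · simp [hq]
  · simp [hp]

theorem isSectorPreserving_krausMap_unitary {V : Matrix A.Idx A.Idx ℂ}
    (hV : V ∈ Matrix.unitaryGroup A.Idx ℂ) (hVA : V ∈ A.sectorAlgebra) :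
    IsSectorPreserving A (krausMap fun _ : Unit => V) := by
  refine ⟨isChannel_krausMap _ ?_, channelFollows_krausMap Sigma.fst (mem_sectorAlgebra_iff.mp hVA)⟩
  simpa [Matrix.star_eq_conjTranspose] using Matrix.mem_unitaryGroup_iff'.mp hV

/-- The isometry `D → D ⊗ ℂ²` that prepares the ancilla in `(3/5) |0⟩ + (4/5) |1⟩` and applies `V`
to `D` controlled by the ancilla; the amplitudes are a rational pair with squares summing to `1`. -/
noncomputable def controlledIsometry (V : Matrix D.Idx D.Idx ℂ) : Matrix (D.Idx × Fin 2) D.Idx ℂ :=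
  Matrix.of fun p x =>
    if p.2 = 0 then (3 / 5) * (1 : Matrix D.Idx D.Idx ℂ) p.1 x else (4 / 5) * V p.1 x

theorem isSectorPreservingMeas_controlledIsometry {V : Matrix D.Idx D.Idx ℂ}
    (hV : V ∈ Matrix.unitaryGroup D.Idx ℂ) (hVD : V ∈ D.sectorAlgebra) :
    IsSectorPreservingMeas D 2 (krausMap fun _ : Unit => controlledIsometry V) := by
  have hVV := Matrix.mem_unitaryGroup_iff'.mp hV
  rw [Matrix.star_eq_conjTranspose] at hVV
  constructor
  · apply isChannel_krausMap
    simp only [Finset.univ_unique, Finset.sum_const, Finset.card_singleton, one_smul]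
    ext x y
    have h := congrFun (congrFun hVV x) y
    have h1 := congrFun (congrFun (one_mul (1 : Matrix D.Idx D.Idx ℂ)) x) y
    nth_rw 1 [← Matrix.conjTranspose_one] at h1
    rw [Matrix.mul_apply] at h h1 ⊢
    simp only [Fintype.sum_prod_type, Fin.sum_univ_two, Matrix.conjTranspose_apply] at h h1 ⊢
    simp only [controlledIsometry, Matrix.of_apply, if_true, Fin.one_eq_zero_iff,
      OfNat.ofNat_ne_one, if_false, star_mul', Finset.sum_add_distrib]
    have e1 : ∀ z, star (3 / 5 : ℂ) * star ((1 : Matrix D.Idx D.Idx ℂ) z x) *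
        (3 / 5 * (1 : Matrix D.Idx D.Idx ℂ) z y) = (9 / 25) *
        (star ((1 : Matrix D.Idx D.Idx ℂ) z x) * (1 : Matrix D.Idx D.Idx ℂ) z y) := by
      intro z
      have : star (3 / 5 : ℂ) = 3 / 5 := by simp
      rw [this]; ring
    have e2 : ∀ z, star (4 / 5 : ℂ) * star (V z x) * (4 / 5 * V z y) = (16 / 25) *
        (star (V z x) * V z y) := by
      intro z
      have : star (4 / 5 : ℂ) = 4 / 5 := by simp
      rw [this]; ring
    simp only [e1, e2, ← Finset.mul_sum, h, h1]
    ring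
  · rw [mem_sectorAlgebra_iff] at hVD
    have hT : ∀ (p : D.Idx × Fin 2) (x : D.Idx), p.1.1 ≠ x.1 → controlledIsometry V p x = 0 := by
      intro p x hpx
      have : p.1 ≠ x := fun h => hpx (by rw [h])
      simp [controlledIsometry, hVD _ _ hpx, this]
    have hF := channelFollows_krausMap (fun p : D.Idx × Fin 2 => p.1.1) hT
    simpa only [proj_kronecker_one] using hF

/-- The off-diagonal element of the ancilla state is the expectation value of `V`, up to a nonzero
factor. -/
theorem traceFst_controlledIsometry (V Y : Matrix D.Idx D.Idx ℂ) :
    traceFst (krausMap (fun _ : Unit => controlledIsometry V) Y) 1 0 =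
      (12 / 25) * (V * Y).trace := by
  simp only [traceFst, krausMap_apply, Finset.univ_unique, Finset.sum_const,
    Finset.card_singleton, one_smul, Matrix.of_apply, Matrix.trace, Matrix.diag_apply,
    Finset.mul_sum]
  refine Finset.sum_congr rfl fun x _ => ?_
  rw [Matrix.mul_apply, Finset.sum_eq_single x]
  · simp only [Matrix.mul_apply, controlledIsometry, Matrix.of_apply, Matrix.conjTranspose_apply,
      Fin.one_eq_zero_iff, OfNat.ofNat_ne_one, if_false, if_true, Matrix.one_apply_eq,
      Finset.sum_mul, Finset.mul_sum]
    refine Finset.sum_congr rfl fun y _ => ?_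
    have : star (3 / 5 * 1 : ℂ) = 3 / 5 := by simp
    rw [this]; ring
  · intro y _ hy
    simp [controlledIsometry, hy.symm]
  · simp

theorem pullbackCommutes_of_noSignalling (h : NoSignalling U) : PullbackCommutes U := by
  refine pullbackCommutes_of_unitary fun V hV hVA V' hV' hVD => ?_
  have h := h _ (isSectorPreserving_krausMap_unitary hV hVA) 2 _
    (isSectorPreservingMeas_controlledIsometry hV' hVD)
  have hV1 := kronecker_one_mul_conjTranspose (n := B.Idx) hV
  simp only [traceFst_idTensor, tensorId_krausMap, Finset.univ_unique, Finset.sum_const,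
    Finset.card_singleton, one_smul] at h
  set v := V ⊗ₖ (1 : Matrix B.Idx B.Idx ℂ)
  set G := Uᴴ * ((1 : Matrix C.Idx C.Idx ℂ) ⊗ₖ V') * U with hG
  have hG' : vᴴ * G * v = G := by
    refine Matrix.ext_iff_trace_mul_right.mpr fun ρ => ?_
    have h1 := congrFun (congrFun (h ρ) 1) 0
    rw [traceFst_controlledIsometry, traceFst_controlledIsometry, trace_mul_traceFst_conj,
      trace_mul_traceFst_conj, ← hG] at h1
    have h2 := mul_left_cancel₀ (by norm_num) h1
    rw [← h2, Matrix.mul_assoc, Matrix.mul_assoc, Matrix.trace_mul_comm]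
    simp only [Matrix.mul_assoc]
  change v * G = G * v
  conv_lhs => rw [← hG']
  rw [← Matrix.mul_assoc, ← Matrix.mul_assoc, hV1, Matrix.one_mul]

end NoSignalling

/-! ### The exchange circuit -/

namespace SectorizedSpace

variable (A : SectorizedSpace)

theorem exchMap_injective : Function.Injective A.exchMap := by
  rintro ⟨⟨i, x⟩, s, w⟩ ⟨⟨j, y⟩, t, v⟩ h
  have : NeZero A.N := ⟨fun h => (h ▸ i).elim0⟩
  simp only [exchMap, Prod.mk.injEq, Sigma.mk.injEq] at h
  obtain ⟨⟨rfl, h1⟩, h2, h3⟩ := h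
  have h1 := eq_of_heq h1
  have hxy : x = y := by simpa using congrFun h2 i
  subst hxy
  have hst : s = t := by
    have := congrArg (fun f => Function.update f i (s i)) h2
    simp only [Function.update_idem, Function.update_eq_self] at this
    rw [this, h1, Function.update_eq_self]
  have hwv : w = v := add_right_cancel h3
  rw [hst, hwv]

theorem exch_apply (y z : A.Idx × A.Anc) : A.exch y z = if y = A.exchMap z then 1 else 0 := rfl

/-- The exchange gate permutes the product basis. -/
noncomputable def exchEquiv : A.Idx × A.Anc ≃ A.Idx × A.Anc :=
  Equiv.ofBijective A.exchMap (Finite.injective_iff_bijective.mp A.exchMap_injective)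

theorem exchEquiv_apply (z : A.Idx × A.Anc) : A.exchEquiv z = A.exchMap z := rfl

/-- The which-sector ancilla reveals the sector, and the sectorial ancilla reveals the vector
in it. -/
theorem exchMap_snd_injective (a : A.Anc) :
    Function.Injective fun x : A.Idx => (A.exchMap (x, a)).2 := by
  obtain ⟨s, w⟩ := a
  rintro ⟨i, x⟩ ⟨j, y⟩ h
  have : NeZero A.N := ⟨fun h => (h ▸ i).elim0⟩
  simp only [exchMap, Prod.mk.injEq] at h
  obtain ⟨h2, h3⟩ := h
  obtain rfl := add_left_cancel h3
  have hxy : x = y := by simpa using congrFun h2 i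
  rw [hxy]

end SectorizedSpace

section ExchangeCircuit

open SectorizedSpace

variable {A B C D : SectorizedSpace} {r : Route A B C D}
  {U : Matrix (C.Idx × D.Idx) (A.Idx × B.Idx) ℂ}

/-- The exchange circuit on basis vectors: the gate on `A` permutes the input labels, and the gate
on `D` permutes the output labels. -/
theorem exchCircuit_apply (U : Matrix (C.Idx × D.Idx) (A.Idx × B.Idx) ℂ)
    (c : C.Idx) (a' : A.Anc) (z : D.Idx × D.Anc) (x : A.Idx) (a : A.Anc) (y : B.Idx)
    (b : D.Anc) :
    exchCircuit U ((c, a'), z) ((x, a), (y, b)) =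
      if a' = (A.exchMap (x, a)).2 ∧ (D.exchEquiv.symm z).2 = b then
        U (c, (D.exchEquiv.symm z).1) ((A.exchMap (x, a)).1, y) else 0 := by
  obtain ⟨⟨d', e⟩, rfl⟩ := D.exchEquiv.surjective z
  rw [Equiv.symm_apply_apply, exchEquiv_apply, exchCircuit, Matrix.mul_apply,
    Finset.sum_eq_single (A.exchMap (x, a), (y, b)),
    Matrix.mul_apply, Finset.sum_eq_single ((c, a'), (d', e))]
  · by_cases h1 : a' = (A.exchMap (x, a)).2 <;> by_cases h2 : e = b <;>
      simp [Matrix.kroneckerMap_apply, exch, Equiv.prodProdProdComm, h1, h2]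
  · rintro ⟨p, q⟩ _ hpq
    rw [Matrix.kroneckerMap_apply, Matrix.one_apply, exch_apply]
    by_cases h1 : (c, a') = p
    · rw [if_neg (c := D.exchMap (d', e) = D.exchMap q), mul_zero, zero_mul]
      intro h2
      exact hpq (by rw [h1, D.exchMap_injective h2])
    · rw [if_neg h1, zero_mul, zero_mul]
  · simp
  · rintro ⟨p, q⟩ _ hpq
    rw [Matrix.kroneckerMap_apply, Matrix.one_apply, exch_apply]
    by_cases h1 : p = A.exchMap (x, a)
    · rw [if_neg (c := q = (y, b)), mul_zero, mul_zero]
      intro h2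
      exact hpq (by rw [h1, h2])
    · rw [if_neg h1, zero_mul, mul_zero]
  · simp

/-- The pullback along `U` of a matrix unit on `D`. -/
theorem pullback_single_apply (d d' : D.Idx) (p q : A.Idx × B.Idx) :
    (Uᴴ * ((1 : Matrix C.Idx C.Idx ℂ) ⊗ₖ Matrix.single d d' (1 : ℂ)) * U) p q =
      ∑ c, star (U (c, d) p) * U (c, d') q := by
  have h : ∀ c z, (((1 : Matrix C.Idx C.Idx ℂ) ⊗ₖ Matrix.single d d' (1 : ℂ)) * U) (c, z) q =
      if z = d then U (c, d') q else 0 := by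
    intro c z
    rw [Matrix.mul_apply, Fintype.sum_prod_type, Finset.sum_eq_single c,
      Finset.sum_eq_single d']
    · simp [Matrix.kroneckerMap_apply, Matrix.single_apply, eq_comm]
    · intro z' _ hz
      simp [Matrix.kroneckerMap_apply, hz.symm]
    · simp
    · intro c' _ hc
      simp [Matrix.kroneckerMap_apply, hc.symm]
    · simp
  rw [Matrix.mul_assoc, Matrix.mul_apply, Fintype.sum_prod_type]
  refine Finset.sum_congr rfl fun c _ => ?_
  simp [h, Matrix.conjTranspose_apply]

/-- The matrix elements of a map in Kraus form, in terms of its Heisenberg-picture observables. -/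
theorem krausMap_apply_apply {m n κ : Type*} [Fintype m] [Fintype κ] (L : κ → Matrix n m ℂ)
    (X : Matrix m m ℂ) (e e' : n) :
    krausMap L X e e' = ∑ u, ∑ v, X u v * ∑ a, star (L a e' v) * L a e u := by
  simp only [krausMap_apply, Matrix.sum_apply, Matrix.mul_apply, Matrix.conjTranspose_apply,
    Finset.sum_mul, Finset.mul_sum]
  rw [Finset.sum_comm, Finset.sum_comm (t := Finset.univ (α := m)) (s := Finset.univ (α := m))]
  refine Finset.sum_congr rfl fun v _ => ?_
  rw [Finset.sum_comm]
  exact Finset.sum_congr rfl fun u _ => Finset.sum_congr rfl fun a _ => by ring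

/-- The observable `S† (1 ⊗ |e'⟩⟨e|) S` on the input of the exchange circuit `S`. -/
noncomputable def exchObservable (U : Matrix (C.Idx × D.Idx) (A.Idx × B.Idx) ℂ) (e' e : D.Anc) :
    Matrix ((A.Idx × A.Anc) × (B.Idx × D.Anc)) ((A.Idx × A.Anc) × (B.Idx × D.Anc)) ℂ :=
  Matrix.of fun p q => ∑ o : D.Idx × (C.Idx × A.Anc),
    star (exchCircuit U (o.2, (o.1, e')) p) * exchCircuit U (o.2, (o.1, e)) q

theorem traceFst_traceFst_exchCircuit
    (ρ : Matrix ((A.Idx × A.Anc) × (B.Idx × D.Anc)) ((A.Idx × A.Anc) × (B.Idx × D.Anc)) ℂ)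
    (e e' : D.Anc) :
    traceFst (traceFst (exchCircuit U * ρ * (exchCircuit U)ᴴ)) e e' =
      ∑ p, ∑ q, ρ p q * exchObservable U e' e q p := by
  have h := krausMap_apply_apply (fun o : D.Idx × (C.Idx × A.Anc) =>
    Matrix.of fun (e : D.Anc) p => exchCircuit U (o.2, (o.1, e)) p) ρ e e'
  refine Eq.trans ?_ h
  rw [krausMap_apply, Matrix.sum_apply, Fintype.sum_prod_type]
  rfl

/-- The observable on `(A ⊗ B) ⊗ D'` obtained by applying only the exchange gate on `D`. -/
noncomputable def outputExchObservable (U : Matrix (C.Idx × D.Idx) (A.Idx × B.Idx) ℂ)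
    (e' e : D.Anc) : Matrix ((A.Idx × B.Idx) × D.Anc) ((A.Idx × B.Idx) × D.Anc) ℂ :=
  Matrix.of fun u v =>
    ∑ d, if (D.exchEquiv.symm (d, e')).2 = u.2 ∧ (D.exchEquiv.symm (d, e)).2 = v.2 then
      (Uᴴ * ((1 : Matrix C.Idx C.Idx ℂ) ⊗ₖ Matrix.single (D.exchEquiv.symm (d, e')).1
        (D.exchEquiv.symm (d, e)).1 (1 : ℂ)) * U) u.1 v.1 else 0

theorem exchObservable_apply (e' e : D.Anc) (x x' : A.Idx) (a a' : A.Anc) (y y' : B.Idx)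
    (b b' : D.Anc) :
    exchObservable U e' e ((x, a), (y, b)) ((x', a'), (y', b')) =
      if (A.exchMap (x, a)).2 = (A.exchMap (x', a')).2 then
        outputExchObservable U e' e (((A.exchMap (x, a)).1, y), b)
          (((A.exchMap (x', a')).1, y'), b')
      else 0 := by
  simp only [exchObservable, outputExchObservable, Matrix.of_apply]
  rw [Fintype.sum_prod_type]
  split_ifs with h
  · refine Finset.sum_congr rfl fun d _ => ?_
    rw [Fintype.sum_prod_type]
    split_ifs with hb
    · rw [pullback_single_apply]
      refine Finset.sum_congr rfl fun c _ => ?_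
      rw [Finset.sum_eq_single (A.exchMap (x, a)).2]
      · rw [exchCircuit_apply, exchCircuit_apply, if_pos ⟨rfl, hb.1⟩, if_pos ⟨h, hb.2⟩]
      · intro w _ hw
        rw [exchCircuit_apply, if_neg fun h => hw h.1, star_zero, zero_mul]
      · simp
    · refine Finset.sum_eq_zero fun c _ => Finset.sum_eq_zero fun w _ => ?_
      rw [exchCircuit_apply, exchCircuit_apply]
      by_cases h1 : (D.exchEquiv.symm (d, e')).2 = b
      · rw [if_neg (c := w = (A.exchMap (x', a')).2 ∧ _) fun h2 => hb ⟨h1, h2.2⟩, mul_zero]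
      · rw [if_neg fun h2 => h1 h2.2, star_zero, zero_mul]
  · refine Finset.sum_eq_zero fun d _ => Finset.sum_eq_zero fun o _ => ?_
    obtain ⟨c, w⟩ := o
    rw [exchCircuit_apply, exchCircuit_apply]
    by_cases h1 : w = (A.exchMap (x, a)).2
    · rw [if_neg (c := w = (A.exchMap (x', a')).2 ∧ _) fun h2 => h (h1.symm.trans h2.1), mul_zero]
    · rw [if_neg fun h2 => h1 h2.1, star_zero, zero_mul]

/-- The pulled-back observables commute with the operators `𝒜 ⊗ L(A')`, among them the exchange
gate on `A`, which therefore has no effect on the outcomes at `D'`. -/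
theorem exchObservable_of_pullbackCommutes (h : PullbackCommutes U) (e' e : D.Anc)
    (x x' : A.Idx) (a a' : A.Anc) (y y' : B.Idx) (b b' : D.Anc) :
    exchObservable U e' e ((x, a), (y, b)) ((x', a'), (y', b')) =
      if a = a' then outputExchObservable U e' e ((x, y), b) ((x', y'), b') else 0 := by
  -- The two matrix units that occur in a summand connect vectors of the same sector of `D`.
  have hsec : ∀ d, (D.exchEquiv.symm (d, e')).1.1 = (D.exchEquiv.symm (d, e)).1.1 := by
    have h1 : ∀ z : D.Idx × D.Anc, (D.exchEquiv.symm z).1.1 = z.1.1 := by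
      intro z
      obtain ⟨z, rfl⟩ := D.exchEquiv.surjective z
      rw [Equiv.symm_apply_apply]
      rfl
    intro d
    rw [h1, h1]
  have hG := fun d => (forall_commute_kronecker_one_iff (n := B.Idx) _).1 fun M hM =>
    h M hM _ (single_mem_sectorAlgebra (hsec d))
  have h0 : ∀ z z' : A.Idx, z ≠ z' →
      outputExchObservable U e' e ((z, y), b) ((z', y'), b') = 0 := by
    intro z z' hz
    rw [outputExchObservable, Matrix.of_apply]
    refine Finset.sum_eq_zero fun d _ => ?_
    rw [(hG d).1 _ _ _ _ hz, ite_self]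
  have h1 : ∀ z z' : A.Idx, z.1 = z'.1 →
      outputExchObservable U e' e ((z, y), b) ((z, y'), b') =
        outputExchObservable U e' e ((z', y), b) ((z', y'), b') := by
    intro z z' hz
    simp only [outputExchObservable, Matrix.of_apply]
    refine Finset.sum_congr rfl fun d _ => ?_
    rw [(hG d).2 _ _ _ _ hz]
  rw [exchObservable_apply]
  by_cases hx : (x, a) = (x', a')
  · obtain ⟨rfl, rfl⟩ := Prod.mk.inj hx
    rw [if_pos rfl, if_pos rfl]
    exact h1 _ _ rfl
  · have hR : (if a = a' then
        outputExchObservable U e' e ((x, y), b) ((x', y'), b') else 0) = 0 := by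
      split_ifs with ha
      · exact h0 _ _ fun hxx => hx (by rw [hxx, ha])
      · rfl
    rw [hR]
    split_ifs with ha
    · exact h0 _ _ fun hxx => hx (A.exchMap_injective (Prod.ext hxx ha))
    · rfl

/-- Moving the ancilla of `A` to the front. -/
def ancFront (A B D : SectorizedSpace) :
    (A.Idx × A.Anc) × (B.Idx × D.Anc) ≃ A.Anc × ((A.Idx × B.Idx) × D.Anc) where
  toFun p := (p.1.2, ((p.1.1, p.2.1), p.2.2))
  invFun p := ((p.2.1.1, p.1), (p.2.1.2, p.2.2))
  left_inv _ := rfl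
  right_inv _ := rfl

theorem sum_discardAnc_mul
    (ρ : Matrix ((A.Idx × A.Anc) × (B.Idx × D.Anc)) ((A.Idx × A.Anc) × (B.Idx × D.Anc)) ℂ)
    (O : Matrix ((A.Idx × B.Idx) × D.Anc) ((A.Idx × B.Idx) × D.Anc) ℂ) :
    ∑ u, ∑ v, discardAnc A B D ρ u v * O v u =
      ∑ p, ∑ q, ρ p q * if q.1.2 = p.1.2 then
        O ((q.1.1, q.2.1), q.2.2) ((p.1.1, p.2.1), p.2.2) else 0 := by
  symm
  rw [← (ancFront A B D).symm.sum_comp, Fintype.sum_prod_type, Finset.sum_comm]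
  refine Finset.sum_congr rfl fun u _ => ?_
  simp only [discardAnc, Matrix.of_apply, Finset.sum_mul]
  refine Eq.trans (Finset.sum_congr rfl fun a _ => ?_) Finset.sum_comm
  rw [← (ancFront A B D).symm.sum_comp, Fintype.sum_prod_type, Finset.sum_eq_single a]
  · refine Finset.sum_congr rfl fun v _ => ?_
    simp [ancFront]
  · intro a' _ ha
    refine Finset.sum_eq_zero fun v _ => ?_
    simp [ancFront, ha]
  · simp

/-- The Kraus operators of `Y ↦ Tr_{CD} [E (U ⊗ 1) Y (U ⊗ 1)† E†]`, where `E` is the exchange gate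
on `D`. -/
noncomputable def exchKraus (U : Matrix (C.Idx × D.Idx) (A.Idx × B.Idx) ℂ) (o : D.Idx × C.Idx) :
    Matrix D.Anc ((A.Idx × B.Idx) × D.Anc) ℂ :=
  Matrix.of fun e u => if (D.exchEquiv.symm (o.1, e)).2 = u.2 then
    U (o.2, (D.exchEquiv.symm (o.1, e)).1) u.1 else 0

theorem sum_star_exchKraus_mul (e' e : D.Anc) (u v : (A.Idx × B.Idx) × D.Anc) :
    ∑ o, star (exchKraus U o e' u) * exchKraus U o e v = outputExchObservable U e' e u v := by
  rw [Fintype.sum_prod_type, outputExchObservable, Matrix.of_apply]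
  refine Finset.sum_congr rfl fun d _ => ?_
  simp only [exchKraus, Matrix.of_apply, pullback_single_apply]
  by_cases h1 : (D.exchEquiv.symm (d, e')).2 = u.2 <;>
    by_cases h2 : (D.exchEquiv.symm (d, e)).2 = v.2 <;> simp [h1, h2]

theorem sum_conjTranspose_exchKraus_mul (hU : IsRoutedUnitary r U) :
    ∑ o, (exchKraus U o)ᴴ * exchKraus U o = r.inProj ⊗ₖ (1 : Matrix D.Anc D.Anc ℂ) := by
  ext ⟨p, b⟩ ⟨q, b'⟩
  rw [Matrix.sum_apply, Fintype.sum_prod_type, Finset.sum_comm]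
  simp only [Matrix.mul_apply, Matrix.conjTranspose_apply, Matrix.kroneckerMap_apply]
  rw [← hU.isometry, Matrix.mul_apply, Fintype.sum_prod_type, Finset.sum_mul]
  refine Finset.sum_congr rfl fun c _ => ?_
  rw [← Fintype.sum_prod_type' (fun d e => star (exchKraus U (d, c) e (p, b)) *
    exchKraus U (d, c) e (q, b')), ← D.exchEquiv.sum_comp, Fintype.sum_prod_type, Finset.sum_mul]
  refine Finset.sum_congr rfl fun d _ => ?_
  rw [Finset.sum_eq_single b]
  · by_cases hb : b = b' <;> simp [exchKraus, Matrix.one_apply, hb]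
  · intro w _ hw
    simp [exchKraus, hw]
  · simp

theorem noAncillaSignalling_of_pullbackCommutes (hD : ∀ l, 0 < D.dim l)
    (hU : IsRoutedUnitary r U) (h : PullbackCommutes U) : NoAncillaSignalling r U := by
  set P := r.inProj ⊗ₖ (1 : Matrix D.Anc D.Anc ℂ) with hP
  have hPP : P * P = P := by
    rw [hP, ← Matrix.mul_kronecker_mul, Route.inProj_mul_self, one_mul]
  have hPh : Pᴴ = P := by
    rw [hP, Matrix.conjTranspose_kronecker, Route.conjTranspose_inProj, Matrix.conjTranspose_one]
  have hKP : ∀ o, exchKraus U o * P = exchKraus U o := by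
    intro o
    ext e ⟨p, b⟩
    have h1 := congrFun (congrFun hU.mul_inProj (o.2, (D.exchEquiv.symm (o.1, e)).1)) p
    rw [Route.inProj, supportProj_eq_diagonal, Matrix.mul_diagonal] at h1
    rw [hP, Route.inProj, supportProj_eq_diagonal, ← Matrix.diagonal_one,
      Matrix.diagonal_kronecker_diagonal, Matrix.mul_diagonal]
    by_cases hb : (D.exchEquiv.symm (o.1, e)).2 = b
    · simpa [exchKraus, hb] using h1
    · simp [exchKraus, hb]
  have hPK : ∀ o, P * (exchKraus U o)ᴴ = (exchKraus U o)ᴴ := by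
    intro o
    have h1 := congrArg Matrix.conjTranspose (hKP o)
    rwa [Matrix.conjTranspose_mul, hPh] at h1
  -- Off the practical input space the channel resets `D'` to a fixed state.
  let z : D.Anc → D.Anc := fun b => (fun l => ⟨0, hD l⟩, b.2)
  let T : ((A.Idx × B.Idx) × D.Anc) → Matrix D.Anc ((A.Idx × B.Idx) × D.Anc) ℂ := fun u =>
    Matrix.single (z u.2) u (1 : ℂ) * (1 - P)
  refine ⟨krausMap (Sum.elim (exchKraus U) T), isChannel_krausMap _ ?_, fun ρ => ?_⟩
  · rw [Fintype.sum_sum_type]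
    simp only [Sum.elim_inl, Sum.elim_inr, T, sum_conjTranspose_exchKraus_mul hU]
    have h1 : ∀ u : (A.Idx × B.Idx) × D.Anc,
        (Matrix.single (z u.2) u (1 : ℂ) * (1 - P) :
          Matrix D.Anc ((A.Idx × B.Idx) × D.Anc) ℂ)ᴴ *
          (Matrix.single (z u.2) u (1 : ℂ) * (1 - P)) =
        (1 - P) * Matrix.single u u 1 * (1 - P) := by
      intro u
      rw [Matrix.conjTranspose_mul, Matrix.conjTranspose_sub, hPh, Matrix.conjTranspose_one,
        Matrix.conjTranspose_single, Matrix.mul_assoc, ← Matrix.mul_assoc (Matrix.single _ _ _),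
        Matrix.single_mul_single_same, Matrix.mul_assoc]
      simp
    simp only [h1, ← Finset.sum_mul, ← Finset.mul_sum, Matrix.sum_single_one]
    rw [← hP]
    simp only [mul_sub, sub_mul, mul_one, one_mul, hPP]
    abel
  · have h1 : krausMap (Sum.elim (exchKraus U) T) (P * discardAnc A B D ρ * P) =
        krausMap (exchKraus U) (discardAnc A B D ρ) := by
      rw [krausMap_apply, Fintype.sum_sum_type, Finset.sum_eq_zero (s := Finset.univ
        (α := (A.Idx × B.Idx) × D.Anc)), add_zero, krausMap_apply]
      · refine Finset.sum_congr rfl fun o _ => ?_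
        rw [Sum.elim_inl, ← Matrix.mul_assoc, ← Matrix.mul_assoc, hKP, Matrix.mul_assoc _ P, hPK]
      · intro u _
        have h2 : (1 - P) * P = 0 := by rw [sub_mul, one_mul, hPP, sub_self]
        rw [Sum.elim_inr, ← Matrix.mul_assoc, ← Matrix.mul_assoc, Matrix.mul_assoc _ (1 - P) P, h2]
        simp
    rw [h1]
    ext e e'
    rw [traceFst_traceFst_exchCircuit, krausMap_apply_apply]
    simp only [sum_star_exchKraus_mul]
    rw [sum_discardAnc_mul]
    exact Finset.sum_congr rfl fun p _ => Finset.sum_congr rfl fun q _ => by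
      rw [← exchObservable_of_pullbackCommutes h]

/-- Starting `D'` in a basis state `b`, the transition of `D'` to the images of `b` under the
exchanges with `d` and `d'` isolates the pullback of the matrix unit at `(d, d')`. -/
theorem outputExchObservable_exchMap {d d' : D.Idx} (hd : d.1 = d'.1) (b : D.Anc)
    (p q : A.Idx × B.Idx) :
    outputExchObservable U (D.exchMap (d, b)).2 (D.exchMap (d', b)).2 (p, b) (q, b) =
      (Uᴴ * ((1 : Matrix C.Idx C.Idx ℂ) ⊗ₖ Matrix.single d d' (1 : ℂ)) * U) p q := by
  have h1 : (D.exchMap (d', b)).1 = (D.exchMap (d, b)).1 := by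
    obtain ⟨l, x⟩ := d
    obtain ⟨l', x'⟩ := d'
    obtain rfl : l = l' := hd
    rfl
  have e1 : D.exchEquiv.symm ((D.exchMap (d, b)).1, (D.exchMap (d, b)).2) = (d, b) :=
    D.exchEquiv.symm_apply_apply (d, b)
  have e2 : D.exchEquiv.symm ((D.exchMap (d, b)).1, (D.exchMap (d', b)).2) = (d', b) := by
    rw [← h1]
    exact D.exchEquiv.symm_apply_apply (d', b)
  rw [outputExchObservable, Matrix.of_apply, Finset.sum_eq_single (D.exchMap (d, b)).1]
  · rw [e1, e2, if_pos ⟨rfl, rfl⟩]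
  · intro w _ hw
    refine if_neg fun hb => hw ?_
    have h2 := D.exchEquiv.apply_symm_apply (w, (D.exchMap (d, b)).2)
    obtain ⟨z, hz⟩ : ∃ z, D.exchEquiv.symm (w, (D.exchMap (d, b)).2) = (z, b) :=
      ⟨_, Prod.ext rfl hb.1⟩
    rw [hz, exchEquiv_apply] at h2
    have h3 : z = d := D.exchMap_snd_injective b (by simp only [h2])
    rw [h3] at h2
    exact (congrArg Prod.fst h2).symm
  · simp

theorem pullbackCommutes_of_noAncillaSignalling (hA : ∀ i, 0 < A.dim i) (hD : ∀ l, 0 < D.dim l)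
    (h : NoAncillaSignalling r U) : PullbackCommutes U := by
  obtain ⟨Φ, _, hΦ⟩ := h
  set P := r.inProj ⊗ₖ (1 : Matrix D.Anc D.Anc ℂ)
  -- Testing on matrix units, only the inputs that are diagonal in the ancilla of `A` contribute,
  -- and their contribution does not depend on the ancilla.
  have hform : ∀ e' e x x' a a' y y' b b',
      exchObservable U e' e ((x, a), (y, b)) ((x', a'), (y', b')) =
        if a = a' then Φ (P * Matrix.single ((x', y'), b') ((x, y), b) 1 * P) e e' else 0 := by
    intro e' e x x' a a' y y' b b'
    have h1 := congrFun (congrFun (hΦ (Matrix.single ((x', a'), (y', b')) ((x, a), (y, b)) 1)) e) e'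
    rw [traceFst_traceFst_exchCircuit, Finset.sum_eq_single ((x', a'), (y', b')),
      Finset.sum_eq_single ((x, a), (y, b)), Matrix.single_apply_same, one_mul] at h1
    · rw [h1]
      have h2 : discardAnc A B D (Matrix.single ((x', a'), (y', b')) ((x, a), (y, b)) 1) =
          if a = a' then Matrix.single ((x', y'), b') ((x, y), b) 1 else 0 := by
        ext ⟨⟨u, v⟩, w⟩ ⟨⟨u', v'⟩, w'⟩
        rw [discardAnc, Matrix.of_apply, Finset.sum_eq_single a]
        · by_cases ha : a = a'
          · simp only [Matrix.single_apply, ha, if_true, Prod.mk.injEq, and_true,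
              and_assoc]
          · rw [if_neg ha, Matrix.single_apply, if_neg]
            · rfl
            · rintro ⟨h3, _⟩
              exact ha (Prod.mk.inj (Prod.mk.inj h3).1).2.symm
        · intro w _ hw
          rw [Matrix.single_apply, if_neg]
          rintro ⟨_, h3⟩
          exact hw (Prod.mk.inj (Prod.mk.inj h3).1).2.symm
        · simp
      rw [h2]
      split_ifs with ha
      · rfl
      · simp
    · intro q _ hq
      rw [Matrix.single_apply, if_neg fun h => hq h.2.symm, zero_mul]
    · simp
    · intro p _ hp
      refine Finset.sum_eq_zero fun q _ => ?_
      rw [Matrix.single_apply, if_neg fun h => hp h.1.symm, zero_mul]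
    · simp
  refine pullbackCommutes_of_single fun d d' hd => (forall_commute_kronecker_one_iff _).2 ?_
  set G := Uᴴ * ((1 : Matrix C.Idx C.Idx ℂ) ⊗ₖ Matrix.single d d' (1 : ℂ)) * U with hG
  have hGh : ∃ g : A.Idx × B.Idx → A.Idx × B.Idx → ℂ, ∀ x x' a a' y y',
      (if (A.exchMap (x, a)).2 = (A.exchMap (x', a')).2 then
        G ((A.exchMap (x, a)).1, y) ((A.exchMap (x', a')).1, y') else 0) =
      if a = a' then g (x, y) (x', y') else 0 := by
    let b : D.Anc := (fun l => ⟨0, hD l⟩, d.1)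
    refine ⟨fun u v => Φ (P * Matrix.single (v, b) (u, b) 1 * P) (D.exchMap (d', b)).2
      (D.exchMap (d, b)).2, fun x x' a a' y y' => ?_⟩
    rw [← hform, exchObservable_apply, outputExchObservable_exchMap hd]
  obtain ⟨g, hg⟩ := hGh
  constructor
  · intro x x' y y' hx
    let a : A.Anc := (fun i => ⟨0, hA i⟩, x.1)
    obtain ⟨⟨z, s⟩, hz⟩ := A.exchEquiv.surjective (x, a)
    obtain ⟨⟨z', s'⟩, hz'⟩ := A.exchEquiv.surjective (x', a)
    rw [exchEquiv_apply] at hz hz'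
    have h1 := hg z z' s s' y y'
    rw [hz, hz', if_pos rfl] at h1
    rw [h1, if_neg]
    rintro rfl
    have h2 : z = z' := A.exchMap_snd_injective s (by simp only [hz, hz'])
    rw [h2, hz'] at hz
    exact hx (congrArg Prod.fst hz).symm
  · rintro ⟨i, u⟩ ⟨j, u'⟩ y y' hij
    obtain rfl : i = j := hij
    -- The vector stored in the ancilla of sector `i` is the one that reaches `U`.
    let a : Fin (A.dim i) → A.Anc := fun w => (Function.update (fun j => ⟨0, hA j⟩) i w, i)
    have h1 : ∀ w, (A.exchMap (⟨i, u⟩, a w)).1 = ⟨i, w⟩ := by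
      intro w
      simp [exchMap, a]
    have h2 : ∀ w, G (⟨i, w⟩, y) (⟨i, w⟩, y') = g (⟨i, u⟩, y) (⟨i, u⟩, y') := by
      intro w
      have h3 := hg ⟨i, u⟩ ⟨i, u⟩ (a w) (a w) y y'
      rwa [if_pos rfl, if_pos rfl, h1] at h3
    rw [h2, h2]

end ExchangeCircuit

theorem theorem3p2 (A B C D : SectorizedSpace)
    (hA : ∀ i, 0 < A.dim i) (hD : ∀ l, 0 < D.dim l)
    (r : Route A B C D) (U : Matrix (C.Idx × D.Idx) (A.Idx × B.Idx) ℂ)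
    (hU : IsRoutedUnitary r U) :
    List.TFAE [NoSignalling U, LocalUnitariesAbsorbed r U, AlgebrasCommute r U,
      NoAncillaSignalling r U] := by
  tfae_have 1 → 3 := fun h => hU.algebrasCommute_iff.mpr (pullbackCommutes_of_noSignalling h)
  tfae_have 3 → 1 := fun h => noSignalling_of_pullbackCommutes hA (hU.algebrasCommute_iff.mp h)
  tfae_have 2 → 3 := fun h =>
    hU.algebrasCommute_iff.mpr (hU.pullbackCommutes_of_localUnitariesAbsorbed h)
  tfae_have 3 → 2 := fun h =>
    hU.localUnitariesAbsorbed_of_pullbackCommutes hD (hU.algebrasCommute_iff.mp h)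
  tfae_have 4 → 3 := fun h =>
    hU.algebrasCommute_iff.mpr (pullbackCommutes_of_noAncillaSignalling hA hD h)
  tfae_have 3 → 4 := fun h =>
    noAncillaSignalling_of_pullbackCommutes hD hU (hU.algebrasCommute_iff.mp h)
  tfae_finish
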